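/- Let $\mathbb K=\mathbb R$ or $\mathbb C$. All Banach spaces are over $\mathbb K$; a pointed metric space is a metric space with a distinguished point $0$ (a Banach space is pointed by its zero vector), and $\mathrm{Lip}_0(X;Y)$ is the set of Lipschitz maps $f\colon X\to Y$ with $f(0)=0$; $\mathrm{Lip}(f)$ is the least Lipschitz constant of $f$. A *Banach linear operator ideal* $\mathcal A$ assigns to all Banach spaces $E,F$ a linear subspace $\mathcal A(E;F)\subset\mathcal L(E;F)$ and a norm $\|\cdot\|_{\mathcal A}$ on it such that $(\mathcal A(E;F),\|\cdot\|_{\mathcal A})$ is a Banach space, $\|T\|\le\|T\|_{\mathcal A}$, $\|Id_{\mathbb K}\|_{\mathcal A}=1$, and $RTS\in\mathcal A$ with $\|RTS\|_{\mathcal A}\le\|R\|\,\|T\|_{\mathcal A}\,\|S\|$ whenever $T\in\mathcal A$ and $R,S$ are bounded operators. A *Banach Lipschitz operator ideal* $\mathcal I$ assigns to every pointed metric space $X$ and Banach space $E$ a linear subspace $\mathcal I(X;E)\subset \mathrm{Lip}_0(X;E)$ and a norm $\|\cdot\|_{\mathcal I}$ on it that makes it a Banach space, with $\mathrm{Lip}(f)\le\|f\|_{\mathcal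 I}$, $\|Id_{\mathbb K}\|_{\mathcal I}=1$, and $S\circ f\circ g\in\mathcal I$ with $\|S\circ f\circ g\|_{\mathcal I}\le \mathrm{Lip}(g)\,\|f\|_{\mathcal I}\,\|S\|$ for $g\in \mathrm{Lip}_0(Y;X)$, $f\in\mathcal I(X;E)$, $S\in\mathcal L(E;F)$. Both kinds of ideals are ordered by continuous inclusion: $\mathcal I\le\mathcal J$ iff $\mathcal I\subset\mathcal J$ and $\|\cdot\|_{\mathcal J}\le\|\cdot\|_{\mathcal I}$ on $\mathcal I$. Equality of ideals means equality of all components with equal norms (isometric equality). For a Banach linear operator ideal $\mathcal A$, let $\psi(\mathcal A)=\mathcal A\circ \mathrm{Lip}_0$ be the Banach Lipschitz operator ideal of all $f\in \mathrm{Lip}_0(X;E)$ that factor as $f=T\circ g$ with $F$ a Banach space, $g\in \mathrm{Lip}_0(X;F)$ and $T\in\mathcal A(F;E)$ (equivalently, the linearization $L_f\colon \text{\AE}(X)\to E$ on the Arens–Eells space belongs to $\mathcal A$), normed by $\|f\|_{\mathcal A\circ \mathrm{Lip}_0}=\|L_f\|_{\mathcal A}$. Here $\text{\AE}(X)$ is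 the closed linear span of the evaluations $\delta_X(x)$, $x \in X$, in the dual of $\mathrm{Lip}_0(X;\mathbb K)$, and $L_f$ is the bounded operator with $L_f\circ\delta_X=f$. The *maximal hull* $\mathcal A^{max}$ consists of the $T\in\mathcal L(E;F)$ with $$\|T\|_{\mathcal A^{max}}=\sup_{M,L}\|q_L\circ T\circ i_M\|_{\mathcal A}<\infty,$$ where $M$ runs over the finite-dimensional subspaces of $E$ (with inclusion $i_M$) and $L$ over the closed finite-codimensional subspaces of $F$ (with quotient map $q_L\colon F\to F/L$). The *maximal hull* $\mathcal I^{max}$ of a Banach Lipschitz operator ideal $\mathcal I$ consists of the $f\in \mathrm{Lip}_0(X;E)$ with $\|f\|_{\mathcal I^{max}}=\sup_{X_0,L}\|q_L\circ f\circ i_{X_0}\|_{\mathcal I}<\infty$, where $X_0$ runs over the finite subsets of $X$ that contain $0$ and $L$ over the closed finite-codimensional subspaces of $E$. Let $$CLIN_{\mathcal A}=\{\mathcal B : \mathcal B(M;N)=\mathcal A(M;N)\text{ isometrically for all finite-dimensional } M,N\},$$ $$CLIP_{\mathcal I}=\{\mathcal J : \mathcal J(X_0;N)=\mathcal I(X_0;N)\text{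 isometrically for all finite pointed } X_0 \text{ and finite-dimensional } N\}.$$ **Proposition.** For every Banach linear operator ideal $\mathcal A$, $$(\mathcal A\circ \mathrm{Lip}_0)^{max}=\psi\Big(\bigvee CLIN_{\mathcal A}\Big)=\psi(\mathcal A^{max})=\mathcal A^{max}\circ \mathrm{Lip}_0\quad\text{isometrically.}$$ Here the suprema exist, $\mathcal A^{max}=\bigvee CLIN_{\mathcal A}$ and $(\mathcal A\circ \mathrm{Lip}_0)^{max}=\bigvee CLIP_{\mathcal A\circ \mathrm{Lip}_0}$, and $\mathcal A^{max}\in CLIN_{\mathcal A}$, $(\mathcal A\circ \mathrm{Lip}_0)^{max}\in CLIP_{\mathcal A\circ \mathrm{Lip}_0}$; that is, the maximal hulls are the biggest ideals that coincide with $\mathcal A$ on finite-dimensional spaces, respectively with $\mathcal A\circ \mathrm{Lip}_0$ on finite pointed metric spaces and finite-dimensional spaces. -/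

import Mathlib

set_option maxSynthPendingDepth 3

open Filter Topology
open scoped NNReal ENNReal

universe u v

noncomputable section

namespace LipIdeals

/-! ### Pointed metric spaces and Lipschitz operators

A pointed metric space is a metric space `X` with a distinguished point `0`
(`[MetricSpace X] [Zero X]`); a normed space is pointed by its zero vector. -/

/-- The least Lipschitz constant of `f` (used for Lipschitz maps only). -/
def lipConst {X Y : Type*} [MetricSpace X] [MetricSpace Y] (f : X → Y) : ℝ≥0 :=
  sInf {K : ℝ≥0 | LipschitzWith K f}

theorem lipConst_le {X Y : Type*} [MetricSpace X] [MetricSpace Y] {f : X → Y} {K : ℝ≥0}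
    (h : LipschitzWith K f) : lipConst f ≤ K :=
  csInf_le (OrderBot.bddBelow _) h

theorem lipschitzWith_lipConst {X Y : Type*} [MetricSpace X] [MetricSpace Y] {f : X → Y}
    (h : ∃ K, LipschitzWith K f) : LipschitzWith (lipConst f) f := by
  refine LipschitzWith.of_dist_le_mul fun x y => ?_
  rcases eq_or_ne x y with rfl | hxy
  · simp
  · have hd : 0 < nndist x y := by
      rw [pos_iff_ne_zero, Ne, nndist_eq_zero]; exact hxy
    have : nndist (f x) (f y) / nndist x y ≤ lipConst f := by
      refine le_csInf h fun K hK => ?_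
      rw [div_le_iff₀ hd]
      exact_mod_cast hK.nndist_le x y
    rw [div_le_iff₀ hd] at this
    exact_mod_cast this

/-- `Lip0 X Y`: the Lipschitz maps `X → Y` that vanish at the distinguished point. -/
structure Lip0 (X : Type*) (Y : Type*) [MetricSpace X] [Zero X] [MetricSpace Y] [Zero Y] where
  toFun : X → Y
  map_zero' : toFun 0 = 0
  lipschitz' : ∃ K, LipschitzWith K toFun

namespace Lip0

section basic

variable {X Y Z : Type*} [MetricSpace X] [Zero X] [MetricSpace Y] [Zero Y]
  [MetricSpace Z] [Zero Z]

instance : FunLike (Lip0 X Y) X Y where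
  coe := toFun
  coe_injective := fun f g h => by cases f; cases g; simpa using h

@[ext] theorem ext {f g : Lip0 X Y} (h : ∀ x, f x = g x) : f = g := DFunLike.ext _ _ h

@[simp] theorem coe_mk (f : X → Y) (h h') : ⇑(Lip0.mk f h h') = f := rfl

@[simp] theorem map_zero (f : Lip0 X Y) : f 0 = 0 := f.map_zero'

/-- `Lip(f)`. -/
def lip (f : Lip0 X Y) : ℝ≥0 := lipConst f

theorem lipschitzWith (f : Lip0 X Y) : LipschitzWith f.lip f := lipschitzWith_lipConst f.lipschitz'

theorem lip_le {f : Lip0 X Y} {K : ℝ≥0} (h : LipschitzWith K f) : f.lip ≤ K := lipConst_le h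

/-- The identity of a pointed metric space. -/
def id (X : Type*) [MetricSpace X] [Zero X] : Lip0 X X := ⟨fun x => x, rfl, 1, LipschitzWith.id⟩

@[simp] theorem id_apply (x : X) : Lip0.id X x = x := rfl

/-- Composition of Lipschitz maps. -/
def comp (g : Lip0 Y Z) (f : Lip0 X Y) : Lip0 X Z :=
  ⟨fun x => g (f x), by simp, g.lip * f.lip, g.lipschitzWith.comp f.lipschitzWith⟩

@[simp] theorem comp_apply (g : Lip0 Y Z) (f : Lip0 X Y) (x : X) : g.comp f x = g (f x) := rfl

theorem lip_comp_le (g : Lip0 Y Z) (f : Lip0 X Y) : (g.comp f).lip ≤ g.lip * f.lip :=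
  lip_le (g.lipschitzWith.comp f.lipschitzWith)

end basic

section vector

variable {X : Type*} [MetricSpace X] [Zero X] {E : Type*} [NormedAddCommGroup E]
  {𝕜 : Type*} [RCLike 𝕜] [NormedSpace 𝕜 E]

theorem lipschitzWith_const_smul (c : 𝕜) (f : Lip0 X E) :
    LipschitzWith (‖c‖₊ * f.lip) (fun x => c • f x) := by
  refine LipschitzWith.of_dist_le_mul fun x y => ?_
  have h := f.lipschitzWith.dist_le_mul x y
  rw [dist_smul₀]
  push_cast
  rw [mul_assoc]
  exact mul_le_mul_of_nonneg_left h (norm_nonneg c)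

/-- The pointwise group structure (an auxiliary step towards the normed group below). -/
abbrev addCommGroupAux (X E : Type*) [MetricSpace X] [Zero X] [NormedAddCommGroup E] :
    AddCommGroup (Lip0 X E) where
  zero := ⟨fun _ => 0, rfl, 0, LipschitzWith.const 0⟩
  add f g := ⟨fun x => f x + g x, by simp, _, f.lipschitzWith.add g.lipschitzWith⟩
  neg f := ⟨fun x => -f x, by simp, _, f.lipschitzWith.neg⟩
  sub f g := ⟨fun x => f x - g x, by simp, _, f.lipschitzWith.sub g.lipschitzWith⟩
  add_assoc f g h := ext fun x => add_assoc (f x) (g x) (h x)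
  zero_add f := ext fun x => zero_add (f x)
  add_zero f := ext fun x => add_zero (f x)
  nsmul := @nsmulRec _ ⟨⟨fun _ => 0, rfl, 0, LipschitzWith.const 0⟩⟩
    ⟨fun f g => ⟨fun x => f x + g x, by simp, _, f.lipschitzWith.add g.lipschitzWith⟩⟩
  zsmul := @zsmulRec _ ⟨⟨fun _ => 0, rfl, 0, LipschitzWith.const 0⟩⟩
    ⟨fun f g => ⟨fun x => f x + g x, by simp, _, f.lipschitzWith.add g.lipschitzWith⟩⟩
    ⟨fun f => ⟨fun x => -f x, by simp, _, f.lipschitzWith.neg⟩⟩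
    (@nsmulRec _ ⟨⟨fun _ => 0, rfl, 0, LipschitzWith.const 0⟩⟩
    ⟨fun f g => ⟨fun x => f x + g x, by simp, _, f.lipschitzWith.add g.lipschitzWith⟩⟩)
  neg_add_cancel f := ext fun x => neg_add_cancel (f x)
  add_comm f g := ext fun x => add_comm (f x) (g x)
  sub_eq_add_neg f g := ext fun x => sub_eq_add_neg (f x) (g x)

/-- `Lip0 X E` is a group under pointwise addition, normed by `Lip(·)`. -/
instance : NormedAddCommGroup (Lip0 X E) :=
  letI := addCommGroupAux X E
  AddGroupNorm.toNormedAddCommGroup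
    { toFun := fun f => f.lip
      map_zero' := by
        have : (0 : Lip0 X E).lip ≤ 0 := lip_le (LipschitzWith.const 0)
        simpa using this
      add_le' := fun f g => by
        exact_mod_cast lip_le (f := f + g) (f.lipschitzWith.add g.lipschitzWith)
      neg' := fun f => by
        have h : ∀ g : Lip0 X E, (-g).lip ≤ g.lip := fun g => lip_le g.lipschitzWith.neg
        have h1 := h f
        have h2 := h (-f)
        rw [neg_neg] at h2
        exact_mod_cast le_antisymm h1 h2
      eq_zero_of_map_eq_zero' := fun f hf => by
        have hf' : f.lip = 0 := by exact_mod_cast hf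
        ext x
        have h := f.lipschitzWith.dist_le_mul x 0
        rw [hf'] at h
        have h0 : f x = 0 := by simpa using h
        exact h0 }

@[simp] theorem zero_apply (x : X) : (0 : Lip0 X E) x = 0 := rfl
@[simp] theorem add_apply (f g : Lip0 X E) (x : X) : (f + g) x = f x + g x := rfl
@[simp] theorem neg_apply (f : Lip0 X E) (x : X) : (-f) x = -f x := rfl
@[simp] theorem sub_apply (f g : Lip0 X E) (x : X) : (f - g) x = f x - g x := rfl

/-- Scalars act on `Lip0 X E` pointwise. -/
instance : NormedSpace 𝕜 (Lip0 X E) where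
  smul c f := ⟨fun x => c • f x, by simp, _, lipschitzWith_const_smul c f⟩
  one_smul f := ext fun x => one_smul 𝕜 (f x)
  mul_smul a b f := ext fun x => mul_smul a b (f x)
  smul_zero a := ext fun _ => smul_zero a
  smul_add a f g := ext fun x => smul_add a (f x) (g x)
  add_smul a b f := ext fun x => add_smul a b (f x)
  zero_smul f := ext fun x => zero_smul 𝕜 (f x)
  norm_smul_le c f := by
    have := lip_le (f := ⟨fun x => c • f x, by simp, _, lipschitzWith_const_smul c f⟩)
      (lipschitzWith_const_smul c f)
    exact_mod_cast this

@[simp] theorem smul_apply (c : 𝕜) (f : Lip0 X E) (x : X) : (c • f) x = c • f x := rfl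

theorem norm_def (f : Lip0 X E) : ‖f‖ = f.lip := rfl

theorem nnnorm_def (f : Lip0 X E) : ‖f‖₊ = f.lip := rfl

theorem norm_sub_le_dist (f : Lip0 X E) (x y : X) : ‖f x - f y‖ ≤ ‖f‖ * dist x y := by
  rw [← dist_eq_norm]; exact f.lipschitzWith.dist_le_mul x y

theorem norm_apply_le (f : Lip0 X E) (x : X) : ‖f x‖ ≤ ‖f‖ * dist x 0 := by
  simpa using f.norm_sub_le_dist x 0

theorem norm_le_of {f : Lip0 X E} {C : ℝ} (hC : 0 ≤ C)
    (h : ∀ x y, ‖f x - f y‖ ≤ C * dist x y) : ‖f‖ ≤ C := by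
  have : f.lip ≤ ⟨C, hC⟩ := lip_le (LipschitzWith.of_dist_le_mul fun x y => by
    rw [dist_eq_norm]; exact h x y)
  exact_mod_cast this

/-- A continuous linear map between normed spaces, as a Lipschitz operator. -/
def ofLinear {F : Type*} [NormedAddCommGroup F] [NormedSpace 𝕜 F] (T : E →L[𝕜] F) : Lip0 E F :=
  ⟨T, by simp, _, T.lipschitz⟩

@[simp] theorem ofLinear_apply {F : Type*} [NormedAddCommGroup F] [NormedSpace 𝕜 F]
    (T : E →L[𝕜] F) (x : E) : ofLinear T x = T x := rfl

theorem norm_ofLinear_comp_le {F : Type*} [NormedAddCommGroup F] [NormedSpace 𝕜 F]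
    (T : E →L[𝕜] F) (f : Lip0 X E) : ‖(ofLinear T).comp f‖ ≤ ‖T‖ * ‖f‖ := by
  refine norm_le_of (by positivity) fun x y => ?_
  simp only [comp_apply, ofLinear_apply, ← map_sub]
  calc _ ≤ ‖T‖ * ‖f x - f y‖ := T.le_opNorm _
    _ ≤ ‖T‖ * (‖f‖ * dist x y) := by gcongr; exact f.norm_sub_le_dist x y
    _ = _ := by ring

end vector

end Lip0

/-! ### The Arens–Eells space and linearization -/

section ArensEells

variable (𝕜 : Type) [RCLike 𝕜] (X : Type u) [MetricSpace X] [Zero X]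

/-- The Dirac map `δ_X : X → (X^#)'`, `δ_X(x)(f) = f(x)`, where `X^# = Lip0 X 𝕜`. -/
def dirac (x : X) : StrongDual 𝕜 (Lip0 X 𝕜) :=
  LinearMap.mkContinuous
    { toFun := fun f => f x
      map_add' := fun _ _ => rfl
      map_smul' := fun _ _ => rfl } (dist x 0) (fun f => by
        rw [mul_comm]; exact f.norm_apply_le x)

@[simp] theorem dirac_apply (x : X) (f : Lip0 X 𝕜) : dirac 𝕜 X x f = f x := rfl

/-- The Arens–Eells (Lipschitz free) space: the closed linear span of the `δ_X(x)` in `(X^#)'`. -/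
def arensEells : Submodule 𝕜 (StrongDual 𝕜 (Lip0 X 𝕜)) :=
  (Submodule.span 𝕜 (Set.range (dirac 𝕜 X))).topologicalClosure

/-- The Arens–Eells space as a type. -/
def AE : Type u := ↥(arensEells 𝕜 X)

instance : NormedAddCommGroup (AE 𝕜 X) := inferInstanceAs (NormedAddCommGroup ↥(arensEells 𝕜 X))

instance : NormedSpace 𝕜 (AE 𝕜 X) := inferInstanceAs (NormedSpace 𝕜 ↥(arensEells 𝕜 X))

instance : CompleteSpace (AE 𝕜 X) :=
  ((Submodule.isClosed_topologicalClosure _).completeSpace_coe :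
    CompleteSpace ↥(arensEells 𝕜 X))

/-- The inclusion of `AE X` in `(X^#)'`. -/
def AE.incl : AE 𝕜 X →L[𝕜] StrongDual 𝕜 (Lip0 X 𝕜) := (arensEells 𝕜 X).subtypeL

variable {X}

theorem dirac_mem (x : X) : dirac 𝕜 X x ∈ arensEells 𝕜 X :=
  Submodule.le_topologicalClosure _ (Submodule.subset_span ⟨x, rfl⟩)

variable (X) in
/-- The Dirac map as a Lipschitz operator `X → AE X`. -/
def diracAE : Lip0 X (AE 𝕜 X) where
  toFun x := ⟨dirac 𝕜 X x, dirac_mem 𝕜 x⟩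
  map_zero' := Subtype.ext (by ext f; exact f.map_zero)
  lipschitz' := ⟨1, LipschitzWith.of_dist_le_mul fun x y => by
    refine (dist_eq_norm (E := AE 𝕜 X) _ _).trans_le ?_
    refine ContinuousLinearMap.opNorm_le_bound _ (by positivity) fun f => ?_
    have := f.norm_sub_le_dist x y
    rw [mul_comm] at this
    rw [NNReal.coe_one, one_mul]
    exact this⟩

@[simp] theorem incl_diracAE (x : X) : AE.incl 𝕜 X (diracAE 𝕜 X x) = dirac 𝕜 X x := rfl

theorem norm_incl (φ : AE 𝕜 X) : ‖AE.incl 𝕜 X φ‖ = ‖φ‖ := rfl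

theorem norm_diracAE_le : ‖diracAE 𝕜 X‖ ≤ 1 := by
  refine Lip0.norm_le_of zero_le_one fun x y => ?_
  refine ContinuousLinearMap.opNorm_le_bound _ (by positivity) fun f => ?_
  have := f.norm_sub_le_dist x y
  rw [mul_comm] at this
  rw [one_mul]
  exact this

/-- Operators on `AE X` are determined by their values on the `δ_X(x)`. -/
theorem AE.hom_ext {F : Type*} [NormedAddCommGroup F] [NormedSpace 𝕜 F] {S T : AE 𝕜 X →L[𝕜] F}
    (h : ∀ x, S (diracAE 𝕜 X x) = T (diracAE 𝕜 X x)) : S = T := by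
  let p : Submodule 𝕜 (StrongDual 𝕜 (Lip0 X 𝕜)) := Submodule.span 𝕜 (Set.range (dirac 𝕜 X))
  have hsub : ∀ (φ : StrongDual 𝕜 (Lip0 X 𝕜)) (_ : φ ∈ p),
      ∃ ψ : AE 𝕜 X, AE.incl 𝕜 X ψ = φ ∧ S ψ = T ψ := by
    intro φ hspan
    induction hspan using Submodule.span_induction with
    | mem φ hφ => obtain ⟨x, rfl⟩ := hφ; exact ⟨_, rfl, h x⟩
    | zero => exact ⟨0, by simp, by simp⟩
    | add a b ha hb iha ihb =>
      obtain ⟨a', ha', ha''⟩ := iha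
      obtain ⟨b', hb', hb''⟩ := ihb
      exact ⟨a' + b', by rw [map_add, ha', hb'], by rw [map_add, map_add, ha'', hb'']⟩
    | smul c a ha iha =>
      obtain ⟨a', ha', ha''⟩ := iha
      exact ⟨c • a', by rw [map_smul, ha'], by rw [map_smul, map_smul, ha'']⟩
  ext φ
  have hφ : AE.incl 𝕜 X φ ∈ closure (p : Set (StrongDual 𝕜 (Lip0 X 𝕜))) := φ.2
  rw [← sub_eq_zero, ← norm_eq_zero, ← _root_.sub_apply]
  refine le_antisymm (le_of_forall_pos_le_add fun ε hε => ?_) (norm_nonneg _)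
  obtain ⟨u, hu, hd⟩ := Metric.mem_closure_iff.1 hφ (ε / (‖S - T‖ + 1)) (by positivity)
  obtain ⟨ψ, rfl, hψ⟩ := hsub u hu
  have e : (S - T) φ = (S - T) (φ - ψ) := by
    rw [map_sub (S - T) φ ψ]
    simp [hψ]
  rw [dist_eq_norm, ← map_sub, norm_incl, lt_div_iff₀ (by positivity)] at hd
  rw [e, zero_add]
  refine ((S - T).le_opNorm _).trans ?_
  nlinarith [norm_nonneg (φ - ψ)]

variable {𝕜}
variable {E : Type v} [NormedAddCommGroup E] [NormedSpace 𝕜 E]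

/-- `e' ↦ e' ∘ f`, an operator `E' → X^#`. -/
def precompDual (f : Lip0 X E) : StrongDual 𝕜 E →L[𝕜] Lip0 X 𝕜 :=
  LinearMap.mkContinuous
    { toFun := fun e' => (Lip0.ofLinear e').comp f
      map_add' := fun _ _ => rfl
      map_smul' := fun _ _ => rfl } ‖f‖ (fun e' => by
        rw [mul_comm]; exact Lip0.norm_ofLinear_comp_le e' f)

theorem norm_precompDual_le (f : Lip0 X E) : ‖precompDual (𝕜 := 𝕜) f‖ ≤ ‖f‖ :=
  LinearMap.mkContinuous_norm_le _ (norm_nonneg _) _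

/-- `φ ↦ (e' ↦ φ(e' ∘ f))`, an operator `AE X → E''`. -/
def preLin (f : Lip0 X E) : AE 𝕜 X →L[𝕜] StrongDual 𝕜 (StrongDual 𝕜 E) :=
  LinearMap.mkContinuous
    { toFun := fun φ => (AE.incl 𝕜 X φ).comp (precompDual (𝕜 := 𝕜) f)
      map_add' := fun _ _ => rfl
      map_smul' := fun _ _ => rfl } ‖f‖ (fun φ => by
        refine (ContinuousLinearMap.opNorm_comp_le _ _).trans ?_
        rw [mul_comm]
        exact mul_le_mul_of_nonneg_right (norm_precompDual_le f) (norm_nonneg _))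

theorem norm_preLin_le (f : Lip0 X E) : ‖preLin (𝕜 := 𝕜) f‖ ≤ ‖f‖ :=
  LinearMap.mkContinuous_norm_le _ (norm_nonneg _) _

theorem preLin_dirac (f : Lip0 X E) (x : X) :
    preLin f (diracAE 𝕜 X x) = NormedSpace.inclusionInDoubleDualLi 𝕜 (f x) := by
  ext e'; rfl

theorem preLin_mem [CompleteSpace E] (f : Lip0 X E) (φ : AE 𝕜 X) :
    ∃ e : E, NormedSpace.inclusionInDoubleDualLi 𝕜 e = preLin f φ := by
  have hcl : IsClosed (Set.range (NormedSpace.inclusionInDoubleDualLi (E := E) 𝕜)) :=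
    ((NormedSpace.inclusionInDoubleDualLi (E := E) 𝕜).isometry.isUniformInducing.isComplete_range).isClosed
  let R : Submodule 𝕜 (StrongDual 𝕜 (StrongDual 𝕜 E)) :=
    (NormedSpace.inclusionInDoubleDualLi (E := E) 𝕜).toLinearMap.range
  have hR : IsClosed (R : Set (StrongDual 𝕜 (StrongDual 𝕜 E))) := hcl
  have : R.mkQL.comp (preLin (𝕜 := 𝕜) f) = 0 := by
    have := hR
    refine AE.hom_ext 𝕜 fun x => ?_
    rw [ContinuousLinearMap.comp_apply, preLin_dirac]
    exact (Submodule.Quotient.mk_eq_zero R).2 ⟨f x, rfl⟩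
  have h2 : R.mkQL (preLin (𝕜 := 𝕜) f φ) = 0 := congrArg (fun T => T φ) this
  exact (Submodule.Quotient.mk_eq_zero R).1 h2

variable (𝕜) in
/-- The value of the linearization of `f` at `φ`: the vector that represents
`e' ↦ φ(e' ∘ f)` in `E''`. -/
def linValue [CompleteSpace E] (f : Lip0 X E) (φ : AE 𝕜 X) : E := (preLin_mem f φ).choose

theorem inclusion_linValue [CompleteSpace E] (f : Lip0 X E) (φ : AE 𝕜 X) :
    NormedSpace.inclusionInDoubleDualLi 𝕜 (linValue 𝕜 f φ) = preLin f φ :=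
  (preLin_mem f φ).choose_spec

theorem linValue_add [CompleteSpace E] (f : Lip0 X E) (φ ψ : AE 𝕜 X) :
    linValue 𝕜 f (φ + ψ) = linValue 𝕜 f φ + linValue 𝕜 f ψ := by
  apply (NormedSpace.inclusionInDoubleDualLi (E := E) 𝕜).injective
  simp only [map_add, inclusion_linValue]

theorem linValue_smul [CompleteSpace E] (f : Lip0 X E) (c : 𝕜) (φ : AE 𝕜 X) :
    linValue 𝕜 f (c • φ) = c • linValue 𝕜 f φ := by
  apply (NormedSpace.inclusionInDoubleDualLi (E := E) 𝕜).injective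
  simp only [map_smul, inclusion_linValue]

theorem norm_linValue_le [CompleteSpace E] (f : Lip0 X E) (φ : AE 𝕜 X) :
    ‖linValue 𝕜 f φ‖ ≤ ‖f‖ * ‖φ‖ := by
  rw [← (NormedSpace.inclusionInDoubleDualLi (E := E) 𝕜).norm_map, inclusion_linValue]
  exact (preLin (𝕜 := 𝕜) f).le_of_opNorm_le (norm_preLin_le (𝕜 := 𝕜) f) φ

variable (𝕜) in
/-- The linearization as a linear map. -/
def linLinear [CompleteSpace E] (f : Lip0 X E) : AE 𝕜 X →ₗ[𝕜] E where
  toFun φ := linValue 𝕜 f φ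
  map_add' φ ψ := linValue_add f φ ψ
  map_smul' c φ := linValue_smul f c φ

variable (𝕜) in
/-- The linearization `L_f : AE X → E` of `f`: the unique operator with `L_f ∘ δ_X = f`. -/
def linearization [CompleteSpace E] (f : Lip0 X E) : AE 𝕜 X →L[𝕜] E :=
  LinearMap.mkContinuous (linLinear 𝕜 f) ‖f‖ (norm_linValue_le f)

@[simp] theorem linearization_dirac [CompleteSpace E] (f : Lip0 X E) (x : X) :
    linearization 𝕜 f (diracAE 𝕜 X x) = f x :=
  (NormedSpace.inclusionInDoubleDualLi (E := E) 𝕜).injective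
    ((inclusion_linValue f (diracAE 𝕜 X x)).trans (preLin_dirac f x))

theorem linearization_unique [CompleteSpace E] {f : Lip0 X E} {T : AE 𝕜 X →L[𝕜] E}
    (h : ∀ x, T (diracAE 𝕜 X x) = f x) : linearization 𝕜 f = T :=
  AE.hom_ext 𝕜 fun x => by rw [h, linearization_dirac]

theorem norm_linearization [CompleteSpace E] (f : Lip0 X E) : ‖linearization 𝕜 f‖ = ‖f‖ := by
  apply le_antisymm
  · exact LinearMap.mkContinuous_norm_le _ (norm_nonneg _) _
  · refine Lip0.norm_le_of (norm_nonneg _) fun x y => ?_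
    rw [← linearization_dirac (𝕜 := 𝕜) f x, ← linearization_dirac (𝕜 := 𝕜) f y, ← map_sub]
    refine (ContinuousLinearMap.le_opNorm _ _).trans ?_
    gcongr
    refine ((diracAE 𝕜 X).norm_sub_le_dist x y).trans ?_
    exact (mul_le_mul_of_nonneg_right (norm_diracAE_le 𝕜) dist_nonneg).trans (one_mul _).le

end ArensEells

/-! ### Complete norms with values in `[0, ∞]` -/

/-- `N : V → [0, ∞]` presents a normed space: the linear subspace `{v | N v < ∞}` of `V`, normed
by `N`, is a Banach space. -/
structure IsBanachENorm (𝕜 : Type) [RCLike 𝕜] {V : Type*} [AddCommGroup V] [Module 𝕜 V]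
    (N : V → ℝ≥0∞) : Prop where
  eq_zero : ∀ v, N v = 0 → v = 0
  add_le : ∀ v w, N (v + w) ≤ N v + N w
  smul : ∀ (c : 𝕜) v, N (c • v) = ‖c‖ₑ * N v
  complete : ∀ u : ℕ → V, (∀ n, N (u n) < ∞) →
    (∀ ε : ℝ≥0∞, 0 < ε → ∃ K, ∀ m ≥ K, ∀ n ≥ K, N (u m - u n) ≤ ε) →
    ∃ v, N v < ∞ ∧ Tendsto (fun n => N (u n - v)) atTop (𝓝 0)

theorem IsBanachENorm.neg {𝕜 : Type} [RCLike 𝕜] {V : Type*} [AddCommGroup V] [Module 𝕜 V]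
    {N : V → ℝ≥0∞} (h : IsBanachENorm 𝕜 N) (v : V) : N (-v) = N v := by
  have := h.smul (-1) v
  simpa using this

/-- The supremum of a family of complete norms, each on the image of a contraction, is a complete
norm provided that it dominates the norm of the (complete) space. -/
theorem IsBanachENorm.iSup {𝕜 : Type} [RCLike 𝕜] {V : Type*} [NormedAddCommGroup V]
    [NormedSpace 𝕜 V] [CompleteSpace V] {ι : Type*} {W : ι → Type*}
    [∀ i, NormedAddCommGroup (W i)] [∀ i, NormedSpace 𝕜 (W i)]
    (Φ : ∀ i, V →ₗ[𝕜] W i) (hΦ : ∀ i v, ‖Φ i v‖ ≤ ‖v‖)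
    (N : ∀ i, W i → ℝ≥0∞) (hN : ∀ i, IsBanachENorm 𝕜 (N i)) (hdom : ∀ i w, ‖w‖ₑ ≤ N i w)
    (hlow : ∀ v, ‖v‖ₑ ≤ ⨆ i, N i (Φ i v)) :
    IsBanachENorm 𝕜 (fun v => ⨆ i, N i (Φ i v)) where
  eq_zero v hv := by
    have := hlow v
    rw [show (⨆ i, N i (Φ i v)) = 0 from hv] at this
    simpa using this
  add_le v w := iSup_le fun i => by
    rw [map_add]
    exact ((hN i).add_le _ _).trans (add_le_add (le_iSup (fun i => N i (Φ i v)) i)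
      (le_iSup (fun i => N i (Φ i w)) i))
  smul c v := by
    simp only [map_smul, (hN _).smul, ENNReal.mul_iSup]
  complete u hu hc := by
    have hcau : CauchySeq u := by
      rw [EMetric.cauchySeq_iff]
      intro ε hε
      obtain ⟨δ, hδ, hδε⟩ := exists_between hε
      obtain ⟨K, hK⟩ := hc δ hδ
      refine ⟨K, fun m hm n hn => ?_⟩
      rw [edist_eq_enorm_sub]
      exact ((hlow _).trans (hK m hm n hn)).trans_lt hδε
    obtain ⟨v, hv⟩ := cauchySeq_tendsto_of_complete hcau
    have key : ∀ ε : ℝ≥0∞, 0 < ε → ∃ K, ∀ n ≥ K, (⨆ i, N i (Φ i (u n - v))) ≤ ε := by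
      intro ε hε
      obtain ⟨K, hK⟩ := hc ε hε
      refine ⟨K, fun n hn => iSup_le fun i => ?_⟩
      obtain ⟨w, hw, hlim⟩ := (hN i).complete (fun n => Φ i (u n))
        (fun n => (le_iSup (fun i => N i (Φ i (u n))) i).trans_lt (hu n)) (fun δ hδ => by
          obtain ⟨K', hK'⟩ := hc δ hδ
          refine ⟨K', fun m hm n hn => ?_⟩
          rw [← map_sub]
          exact (le_iSup (fun i => N i (Φ i (u m - u n))) i).trans (hK' m hm n hn))
      have h1 : Tendsto (fun n => Φ i (u n)) atTop (𝓝 w) := by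
        rw [tendsto_iff_edist_tendsto_0]
        refine tendsto_of_tendsto_of_tendsto_of_le_of_le tendsto_const_nhds hlim
          (fun _ => zero_le) fun n => ?_
        rw [edist_eq_enorm_sub]
        exact hdom i _
      have h2 : Tendsto (fun n => Φ i (u n)) atTop (𝓝 (Φ i v)) :=
        (((Φ i).mkContinuous 1 (by simpa using hΦ i)).continuous.tendsto v).comp hv
      obtain rfl := tendsto_nhds_unique h1 h2
      have h3 : Tendsto (fun m => ε + N i (Φ i (u m) - Φ i v)) atTop (𝓝 (ε + 0)) :=
        tendsto_const_nhds.add hlim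
      rw [add_zero] at h3
      refine ge_of_tendsto h3 (eventually_atTop.2 ⟨K, fun m hm => ?_⟩)
      have e : Φ i (u n - v) = Φ i (u n - u m) + (Φ i (u m) - Φ i v) := by
        simp only [map_sub]; abel
      rw [e]
      exact ((hN i).add_le _ _).trans (add_le_add_left
        ((le_iSup (fun i => N i (Φ i (u n - u m))) i).trans (hK n hn m hm)) _)
    refine ⟨v, ?_, ENNReal.tendsto_atTop_zero.2 key⟩
    obtain ⟨K, hK⟩ := key 1 one_pos
    refine lt_of_le_of_lt (iSup_le fun i => ?_)
      (ENNReal.add_lt_top.2 ⟨hu K, (hK K le_rfl).trans_lt ENNReal.one_lt_top⟩)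
    have e : Φ i v = Φ i (u K) + -(Φ i (u K - v)) := by
      simp only [map_sub]; abel
    rw [e]
    refine ((hN i).add_le _ _).trans ?_
    rw [(hN i).neg]
    exact add_le_add (le_iSup (fun i => N i (Φ i (u K))) i)
      (le_iSup (fun i => N i (Φ i (u K - v))) i)

/-! ### Banach linear operator ideals and Banach Lipschitz operator ideals -/

/-- A Banach linear operator ideal `𝒜` (on all Banach spaces over `𝕜` in the universe `u`). It is
given by the ideal norm `nrm`, extended by `∞` to the operators that are not in the ideal:
`𝒜(E; F) = {T | nrm T < ∞}`. -/
structure BanachLinIdeal (𝕜 : Type) [RCLike 𝕜] : Type (u + 1) where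
  /-- The ideal norm; `∞` outside the ideal. -/
  nrm : ∀ {E F : Type u} [NormedAddCommGroup E] [NormedSpace 𝕜 E] [CompleteSpace E]
    [NormedAddCommGroup F] [NormedSpace 𝕜 F] [CompleteSpace F], (E →L[𝕜] F) → ℝ≥0∞
  /-- Every component is a linear subspace, and a Banach space in the ideal norm. -/
  banach : ∀ (E F : Type u) [NormedAddCommGroup E] [NormedSpace 𝕜 E] [CompleteSpace E]
    [NormedAddCommGroup F] [NormedSpace 𝕜 F] [CompleteSpace F],
    IsBanachENorm 𝕜 (fun T : E →L[𝕜] F => nrm T)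
  /-- `‖T‖ ≤ ‖T‖_𝒜`. -/
  enorm_le : ∀ {E F : Type u} [NormedAddCommGroup E] [NormedSpace 𝕜 E] [CompleteSpace E]
    [NormedAddCommGroup F] [NormedSpace 𝕜 F] [CompleteSpace F] (T : E →L[𝕜] F), ‖T‖ₑ ≤ nrm T
  /-- The identity of the scalar field is in the ideal, with norm one. -/
  nrm_id : nrm (ContinuousLinearMap.id 𝕜 (ULift.{u} 𝕜)) = 1
  /-- The ideal property, with its norm inequality. -/
  nrm_comp_le : ∀ {E₀ E F F₀ : Type u}
    [NormedAddCommGroup E₀] [NormedSpace 𝕜 E₀] [CompleteSpace E₀]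
    [NormedAddCommGroup E] [NormedSpace 𝕜 E] [CompleteSpace E]
    [NormedAddCommGroup F] [NormedSpace 𝕜 F] [CompleteSpace F]
    [NormedAddCommGroup F₀] [NormedSpace 𝕜 F₀] [CompleteSpace F₀]
    (R : F →L[𝕜] F₀) (T : E →L[𝕜] F) (S : E₀ →L[𝕜] E),
    nrm (R ∘L T ∘L S) ≤ ‖R‖ₑ * nrm T * ‖S‖ₑ

/-- A Banach Lipschitz operator ideal `ℐ` (on all pointed metric spaces and all Banach spaces over
`𝕜` in the universe `u`). It is given by the ideal norm `nrm`, extended by `∞` to the Lipschitz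
operators that are not in the ideal: `ℐ(X; E) = {f ∈ Lip0 X E | nrm f < ∞}`. -/
structure BanachLipIdeal (𝕜 : Type) [RCLike 𝕜] : Type (u + 1) where
  /-- The ideal norm; `∞` outside the ideal. -/
  nrm : ∀ {X E : Type u} [MetricSpace X] [Zero X]
    [NormedAddCommGroup E] [NormedSpace 𝕜 E] [CompleteSpace E], Lip0 X E → ℝ≥0∞
  /-- Every component is a linear subspace, and a Banach space in the ideal norm. -/
  banach : ∀ (X E : Type u) [MetricSpace X] [Zero X]
    [NormedAddCommGroup E] [NormedSpace 𝕜 E] [CompleteSpace E],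
    IsBanachENorm 𝕜 (fun f : Lip0 X E => nrm f)
  /-- `Lip(f) ≤ ‖f‖_ℐ`. -/
  lip_le : ∀ {X E : Type u} [MetricSpace X] [Zero X]
    [NormedAddCommGroup E] [NormedSpace 𝕜 E] [CompleteSpace E] (f : Lip0 X E),
    (f.lip : ℝ≥0∞) ≤ nrm f
  /-- The identity of the scalar field is in the ideal, with norm one. -/
  nrm_id : nrm (Lip0.id (ULift.{u} 𝕜)) = 1
  /-- The ideal property, with its norm inequality. -/
  nrm_comp_le : ∀ {Y X E F : Type u} [MetricSpace Y] [Zero Y] [MetricSpace X] [Zero X]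
    [NormedAddCommGroup E] [NormedSpace 𝕜 E] [CompleteSpace E]
    [NormedAddCommGroup F] [NormedSpace 𝕜 F] [CompleteSpace F]
    (S : E →L[𝕜] F) (f : Lip0 X E) (g : Lip0 Y X),
    nrm ((Lip0.ofLinear S).comp (f.comp g)) ≤ (g.lip : ℝ≥0∞) * nrm f * ‖S‖ₑ

namespace BanachLinIdeal

variable {𝕜 : Type} [RCLike 𝕜]

theorem nrm_injective {A B : BanachLinIdeal.{u} 𝕜}
    (h : ∀ (E F : Type u) [NormedAddCommGroup E] [NormedSpace 𝕜 E] [CompleteSpace E]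
      [NormedAddCommGroup F] [NormedSpace 𝕜 F] [CompleteSpace F] (T : E →L[𝕜] F),
      A.nrm T = B.nrm T) : A = B := by
  cases A; cases B
  congr
  funext E F i1 i2 i3 i4 i5 i6 T
  exact h E F T

/-- Continuous inclusion: `𝒜 ≤ ℬ` iff `𝒜 ⊆ ℬ` and `‖T‖_ℬ ≤ ‖T‖_𝒜` for all `T ∈ 𝒜`.
Equality in this partial order is isometric equality. -/
instance : PartialOrder (BanachLinIdeal.{u} 𝕜) where
  le A B := ∀ (E F : Type u) [NormedAddCommGroup E] [NormedSpace 𝕜 E] [CompleteSpace E]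
    [NormedAddCommGroup F] [NormedSpace 𝕜 F] [CompleteSpace F] (T : E →L[𝕜] F),
    A.nrm T < ∞ → B.nrm T < ∞ ∧ B.nrm T ≤ A.nrm T
  le_refl _ _ _ _ _ _ _ _ _ _ h := ⟨h, le_rfl⟩
  le_trans _ _ _ h1 h2 E F _ _ _ _ _ _ T h :=
    ⟨(h2 E F T (h1 E F T h).1).1, (h2 E F T (h1 E F T h).1).2.trans (h1 E F T h).2⟩
  le_antisymm A B h1 h2 := nrm_injective fun E F _ _ _ _ _ _ T => by
    rcases eq_or_ne (A.nrm T) ∞ with hA | hA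
    · rcases eq_or_ne (B.nrm T) ∞ with hB | hB
      · rw [hA, hB]
      · exact absurd hA (h2 E F T hB.lt_top).1.ne
    · exact le_antisymm (h2 E F T (h1 E F T hA.lt_top).1).2 (h1 E F T hA.lt_top).2

end BanachLinIdeal

namespace BanachLipIdeal

variable {𝕜 : Type} [RCLike 𝕜]

theorem nrm_injective {I J : BanachLipIdeal.{u} 𝕜}
    (h : ∀ (X E : Type u) [MetricSpace X] [Zero X] [NormedAddCommGroup E] [NormedSpace 𝕜 E]
      [CompleteSpace E] (f : Lip0 X E), I.nrm f = J.nrm f) : I = J := by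
  cases I; cases J
  congr
  funext X E i1 i2 i3 i4 i5 f
  exact h X E f

/-- Continuous inclusion: `ℐ ≤ 𝒥` iff `ℐ ⊆ 𝒥` and `‖f‖_𝒥 ≤ ‖f‖_ℐ` for all `f ∈ ℐ`.
Equality in this partial order is isometric equality. -/
instance : PartialOrder (BanachLipIdeal.{u} 𝕜) where
  le I J := ∀ (X E : Type u) [MetricSpace X] [Zero X] [NormedAddCommGroup E] [NormedSpace 𝕜 E]
    [CompleteSpace E] (f : Lip0 X E), I.nrm f < ∞ → J.nrm f < ∞ ∧ J.nrm f ≤ I.nrm f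
  le_refl _ _ _ _ _ _ _ _ _ h := ⟨h, le_rfl⟩
  le_trans _ _ _ h1 h2 X E _ _ _ _ _ f h :=
    ⟨(h2 X E f (h1 X E f h).1).1, (h2 X E f (h1 X E f h).1).2.trans (h1 X E f h).2⟩
  le_antisymm I J h1 h2 := nrm_injective fun X E _ _ _ _ _ f => by
    rcases eq_or_ne (I.nrm f) ∞ with hA | hA
    · rcases eq_or_ne (J.nrm f) ∞ with hB | hB
      · rw [hA, hB]
      · exact absurd hA (h2 X E f hB.lt_top).1.ne
    · exact le_antisymm (h2 X E f (h1 X E f hA.lt_top).1).2 (h1 X E f hA.lt_top).2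

end BanachLipIdeal

/-- `CLIN_𝒜`: the Banach linear operator ideals that coincide isometrically with `𝒜` on the
finite-dimensional spaces. -/
def CLIN {𝕜 : Type} [RCLike 𝕜] (A : BanachLinIdeal.{u} 𝕜) : Set (BanachLinIdeal.{u} 𝕜) :=
  {B | ∀ (M N : Type u) [NormedAddCommGroup M] [NormedSpace 𝕜 M] [CompleteSpace M]
    [NormedAddCommGroup N] [NormedSpace 𝕜 N] [CompleteSpace N]
    [FiniteDimensional 𝕜 M] [FiniteDimensional 𝕜 N] (T : M →L[𝕜] N), B.nrm T = A.nrm T}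

/-- `CLIP_ℐ`: the Banach Lipschitz operator ideals that coincide isometrically with `ℐ` on the
finite pointed metric spaces and the finite-dimensional spaces. -/
def CLIP {𝕜 : Type} [RCLike 𝕜] (I : BanachLipIdeal.{u} 𝕜) : Set (BanachLipIdeal.{u} 𝕜) :=
  {J | ∀ (X₀ N : Type u) [MetricSpace X₀] [Zero X₀] [Finite X₀] [NormedAddCommGroup N]
    [NormedSpace 𝕜 N] [CompleteSpace N] [FiniteDimensional 𝕜 N] (f : Lip0 X₀ N),
    J.nrm f = I.nrm f}

/-! ### The composition ideal `𝒜 ∘ Lip0` -/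

section Composition

variable {𝕜 : Type} [RCLike 𝕜]

theorem linearization_add {X E : Type*} [MetricSpace X] [Zero X] [NormedAddCommGroup E]
    [NormedSpace 𝕜 E] [CompleteSpace E] (f g : Lip0 X E) :
    linearization 𝕜 (f + g) = linearization 𝕜 f + linearization 𝕜 g :=
  linearization_unique fun x => by simp

theorem linearization_sub {X E : Type*} [MetricSpace X] [Zero X] [NormedAddCommGroup E]
    [NormedSpace 𝕜 E] [CompleteSpace E] (f g : Lip0 X E) :
    linearization 𝕜 (f - g) = linearization 𝕜 f - linearization 𝕜 g :=
  linearization_unique fun x => by simp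

theorem linearization_smul {X E : Type*} [MetricSpace X] [Zero X] [NormedAddCommGroup E]
    [NormedSpace 𝕜 E] [CompleteSpace E] (c : 𝕜) (f : Lip0 X E) :
    linearization 𝕜 (c • f) = c • linearization 𝕜 f :=
  linearization_unique fun x => by simp

theorem linearization_comp_diracAE {X E : Type*} [MetricSpace X] [Zero X] [NormedAddCommGroup E]
    [NormedSpace 𝕜 E] [CompleteSpace E] (T : AE 𝕜 X →L[𝕜] E) :
    linearization 𝕜 ((Lip0.ofLinear T).comp (diracAE 𝕜 X)) = T :=
  linearization_unique fun x => by simp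

/-- `L_{S ∘ f} = S ∘ L_f`. -/
theorem linearization_ofLinear_comp {X E F : Type*} [MetricSpace X] [Zero X]
    [NormedAddCommGroup E] [NormedSpace 𝕜 E] [CompleteSpace E]
    [NormedAddCommGroup F] [NormedSpace 𝕜 F] [CompleteSpace F] (S : E →L[𝕜] F) (f : Lip0 X E) :
    linearization 𝕜 ((Lip0.ofLinear S).comp f) = S ∘L linearization 𝕜 f :=
  linearization_unique fun x => by simp

/-- `L_{f ∘ g} = L_f ∘ ĝ`. -/
theorem linearization_comp {X Y E : Type*} [MetricSpace X] [Zero X] [MetricSpace Y] [Zero Y]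
    [NormedAddCommGroup E] [NormedSpace 𝕜 E] [CompleteSpace E] (f : Lip0 X E) (g : Lip0 Y X) :
    linearization 𝕜 (f.comp g) =
      linearization 𝕜 f ∘L linearization 𝕜 ((diracAE 𝕜 X).comp g) :=
  linearization_unique fun x => by simp

theorem lip_eq_enorm {X E : Type*} [MetricSpace X] [Zero X] [NormedAddCommGroup E]
    (f : Lip0 X E) : (f.lip : ℝ≥0∞) = ‖f‖ₑ := rfl

theorem enorm_linearization {X E : Type*} [MetricSpace X] [Zero X] [NormedAddCommGroup E]
    [NormedSpace 𝕜 E] [CompleteSpace E] (f : Lip0 X E) : ‖linearization 𝕜 f‖ₑ = ‖f‖ₑ := by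
  rw [← ofReal_norm, ← ofReal_norm, norm_linearization]

theorem Lip0.completeSpace (𝕜 : Type) [RCLike 𝕜] (X E : Type*) [MetricSpace X] [Zero X]
    [NormedAddCommGroup E] [NormedSpace 𝕜 E] [CompleteSpace E] : CompleteSpace (Lip0 X E) := by
  refine Metric.complete_of_cauchySeq_tendsto fun u hu => ?_
  have hc : CauchySeq fun n => linearization 𝕜 (u n) := by
    rw [Metric.cauchySeq_iff] at hu ⊢
    intro ε hε
    obtain ⟨K, hK⟩ := hu ε hε
    refine ⟨K, fun m hm n hn => ?_⟩
    rw [dist_eq_norm, ← linearization_sub, norm_linearization, ← dist_eq_norm]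
    exact hK m hm n hn
  obtain ⟨T, hT⟩ := cauchySeq_tendsto_of_complete hc
  refine ⟨(Lip0.ofLinear T).comp (diracAE 𝕜 X), ?_⟩
  rw [tendsto_iff_norm_sub_tendsto_zero] at hT ⊢
  refine hT.congr fun n => ?_
  rw [← norm_linearization (𝕜 := 𝕜) (u n - _), linearization_sub, linearization_comp_diracAE]

/-- The ideal `𝒜 ∘ Lip0`: `‖f‖_{𝒜 ∘ Lip0} = ‖L_f‖_𝒜`. -/
def BanachLinIdeal.compLip0 (A : BanachLinIdeal.{u} 𝕜) : BanachLipIdeal.{u} 𝕜 where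
  nrm f := A.nrm (linearization 𝕜 f)
  banach X E _ _ _ _ _ :=
    { eq_zero := fun f hf => by
        have := (A.banach (AE 𝕜 X) E).eq_zero _ hf
        have h2 := norm_linearization (𝕜 := 𝕜) f
        rw [this, norm_zero] at h2
        exact norm_eq_zero.1 h2.symm
      add_le := fun f g => by
        rw [linearization_add]; exact (A.banach (AE 𝕜 X) E).add_le _ _
      smul := fun c f => by
        rw [linearization_smul]; exact (A.banach (AE 𝕜 X) E).smul _ _
      complete := fun u hu hc => by
        obtain ⟨T, hT, hlim⟩ := (A.banach (AE 𝕜 X) E).complete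
          (fun n => linearization 𝕜 (u n)) hu (by simpa only [linearization_sub] using hc)
        refine ⟨(Lip0.ofLinear T).comp (diracAE 𝕜 X), ?_, ?_⟩
        · rw [linearization_comp_diracAE]; exact hT
        · simpa only [linearization_sub, linearization_comp_diracAE] using hlim }
  lip_le f := by
    rw [lip_eq_enorm, ← enorm_linearization (𝕜 := 𝕜)]; exact A.enorm_le _
  nrm_id := by
    apply le_antisymm
    · have h := A.nrm_comp_le (ContinuousLinearMap.id 𝕜 (ULift.{u} 𝕜))
        (ContinuousLinearMap.id 𝕜 (ULift.{u} 𝕜)) (linearization 𝕜 (Lip0.id (ULift.{u} 𝕜)))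
      rw [A.nrm_id, enorm_linearization, ContinuousLinearMap.id_comp,
        ContinuousLinearMap.id_comp, mul_one] at h
      refine h.trans ?_
      have h1 : ‖ContinuousLinearMap.id 𝕜 (ULift.{u} 𝕜)‖ₑ ≤ 1 := by
        rw [← A.nrm_id]; exact A.enorm_le _
      have h2 : ‖Lip0.id (ULift.{u} 𝕜)‖ₑ ≤ 1 := by
        rw [← lip_eq_enorm]
        exact_mod_cast Lip0.lip_le (f := Lip0.id (ULift.{u} 𝕜)) LipschitzWith.id
      exact (mul_le_mul' h1 h2).trans (one_mul _).le
    · refine le_trans ?_ (A.enorm_le _)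
      rw [enorm_linearization, ← lip_eq_enorm]
      have h3 := (Lip0.id (ULift.{u} 𝕜)).lipschitzWith.edist_le_mul (ULift.up 1) 0
      have h4 : edist (ULift.up (1 : 𝕜)) 0 = 1 := by
        rw [edist_zero_right, ← ofReal_norm, ULift.norm_up, norm_one, ENNReal.ofReal_one]
      rw [Lip0.id_apply, Lip0.id_apply, h4, mul_one] at h3
      exact h3
  nrm_comp_le {Y X E F} _ _ _ _ _ _ _ _ _ _ S f g := by
    rw [linearization_ofLinear_comp, linearization_comp]
    refine (A.nrm_comp_le _ _ _).trans ?_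
    have h0 : ∀ a b c : ℝ≥0∞, a * b * c = c * b * a := fun a b c => by ring
    rw [h0]
    have h1 := (diracAE 𝕜 X).lip_comp_le g
    have h2 : (diracAE 𝕜 X).lip ≤ 1 := by exact_mod_cast norm_diracAE_le 𝕜
    have h3 := h1.trans ((mul_le_mul' h2 le_rfl).trans (one_mul _).le)
    have h4 : ‖linearization 𝕜 ((diracAE 𝕜 X).comp g)‖ₑ ≤ (g.lip : ℝ≥0∞) := by
      rw [enorm_linearization, ← lip_eq_enorm]
      exact_mod_cast h3
    exact mul_le_mul' (mul_le_mul' h4 le_rfl) le_rfl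

/-- `𝒜 ∘ Lip0` consists of the Lipschitz operators that factor as `T ∘ g` with `T ∈ 𝒜` and `g` a
Lipschitz operator into a Banach space. -/
theorem BanachLinIdeal.compLip0_nrm_lt_top_iff (A : BanachLinIdeal.{u} 𝕜) {X E : Type u}
    [MetricSpace X] [Zero X] [NormedAddCommGroup E] [NormedSpace 𝕜 E] [CompleteSpace E]
    (f : Lip0 X E) :
    A.compLip0.nrm f < ∞ ↔ ∃ (F : Type u) (_ : NormedAddCommGroup F) (_ : NormedSpace 𝕜 F)
      (_ : CompleteSpace F) (g : Lip0 X F) (T : F →L[𝕜] E),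
      A.nrm T < ∞ ∧ ∀ x, f x = T (g x) := by
  constructor
  · intro h
    exact ⟨AE 𝕜 X, inferInstance, inferInstance, inferInstance, diracAE 𝕜 X, linearization 𝕜 f, h,
      fun x => (linearization_dirac f x).symm⟩
  · rintro ⟨F, _, _, _, g, T, hT, hf⟩
    have e : linearization 𝕜 f = ContinuousLinearMap.id 𝕜 E ∘L T ∘L linearization 𝕜 g :=
      linearization_unique fun x => by simp [hf]
    change A.nrm (linearization 𝕜 f) < ∞
    rw [e]
    exact (A.nrm_comp_le _ _ _).trans_lt (ENNReal.mul_lt_top (ENNReal.mul_lt_top enorm_lt_top hT)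
      enorm_lt_top)

end Composition

/-! ### Maximal hulls -/

/-- `FIN(E)`: the finite-dimensional subspaces of `E`. -/
structure FinDimSubspace (𝕜 E : Type*) [RCLike 𝕜] [NormedAddCommGroup E] [NormedSpace 𝕜 E] where
  space : Submodule 𝕜 E
  finDim : FiniteDimensional 𝕜 space

/-- `COFIN(F)`: the closed subspaces of `F` of finite codimension. -/
structure CofinSubspace (𝕜 F : Type*) [RCLike 𝕜] [NormedAddCommGroup F] [NormedSpace 𝕜 F] where
  space : Submodule 𝕜 F
  closed : IsClosed (space : Set F)
  finCodim : FiniteDimensional 𝕜 (F ⧸ space)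

/-- `MFIN(X)`: the finite subsets of `X` that contain the distinguished point. -/
structure FinPointedSubset (X : Type*) [Zero X] where
  carrier : Set X
  finite : carrier.Finite
  zero_mem : (0 : X) ∈ carrier

attribute [instance] FinDimSubspace.finDim CofinSubspace.closed CofinSubspace.finCodim

instance {𝕜 E : Type*} [RCLike 𝕜] [NormedAddCommGroup E] [NormedSpace 𝕜 E]
    (M : FinDimSubspace 𝕜 E) : CompleteSpace M.space := FiniteDimensional.complete 𝕜 M.space

instance {X : Type*} [Zero X] (X₀ : FinPointedSubset X) : Zero X₀.carrier := ⟨⟨0, X₀.zero_mem⟩⟩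

/-- The inclusion of a finite pointed subset. -/
def FinPointedSubset.incl {X : Type*} [MetricSpace X] [Zero X] (X₀ : FinPointedSubset X) :
    Lip0 X₀.carrier X :=
  ⟨fun x => x, rfl, 1, LipschitzWith.subtype_val _⟩

section HullAux

variable {𝕜 : Type} [RCLike 𝕜]

theorem norm_mkQL_le {F : Type*} [NormedAddCommGroup F] [NormedSpace 𝕜 F]
    (L : CofinSubspace 𝕜 F) : ‖L.space.mkQL‖ ≤ 1 :=
  ContinuousLinearMap.opNorm_le_bound _ zero_le_one fun x => by
    rw [one_mul]; exact Submodule.Quotient.norm_mk_le L.space x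

theorem enorm_mkQL_le {F : Type*} [NormedAddCommGroup F] [NormedSpace 𝕜 F]
    (L : CofinSubspace 𝕜 F) : ‖L.space.mkQL‖ₑ ≤ 1 := by
  rw [← ofReal_norm]
  exact (ENNReal.ofReal_le_ofReal (norm_mkQL_le L)).trans ENNReal.ofReal_one.le

theorem enorm_subtypeL_le {E : Type*} [NormedAddCommGroup E] [NormedSpace 𝕜 E]
    (M : FinDimSubspace 𝕜 E) : ‖M.space.subtypeL‖ₑ ≤ 1 := by
  rw [← ofReal_norm]
  exact (ENNReal.ofReal_le_ofReal (M.space.norm_subtypeL_le)).trans ENNReal.ofReal_one.le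

theorem norm_lift_le {F G : Type*} [NormedAddCommGroup F] [NormedSpace 𝕜 F]
    [NormedAddCommGroup G] [NormedSpace 𝕜 G] (K : Submodule 𝕜 F) (T : F →L[𝕜] G)
    (h : K ≤ T.ker) : ‖K.liftQL T h‖ ≤ ‖T‖ := by
  refine ContinuousLinearMap.opNorm_le_bound _ (norm_nonneg _) fun x => ?_
  refine le_of_forall_pos_le_add fun ε hε => ?_
  obtain ⟨m, rfl, hm⟩ := Submodule.Quotient.norm_mk_lt x
    (show 0 < ε / (‖T‖ + 1) by positivity)
  have h1 : K.liftQL T h (Submodule.Quotient.mk m) = T m := rfl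
  rw [h1]
  refine (T.le_opNorm m).trans ((mul_le_mul_of_nonneg_left hm.le (norm_nonneg _)).trans ?_)
  rw [mul_add]
  gcongr
  rw [← mul_div_assoc, div_le_iff₀ (by positivity)]
  nlinarith [norm_nonneg T]

/-- Every vector is normed by a finite-codimensional quotient. -/
theorem exists_cofin_norm {F : Type*} [NormedAddCommGroup F] [NormedSpace 𝕜 F] (y : F) :
    ∃ L : CofinSubspace 𝕜 F, ‖y‖ ≤ ‖L.space.mkQL y‖ := by
  obtain ⟨φ, hφ, hy⟩ := exists_dual_vector'' 𝕜 y
  have hfin : FiniteDimensional 𝕜 (F ⧸ φ.toLinearMap.ker) :=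
    φ.toLinearMap.quotKerEquivRange.symm.finiteDimensional
  refine ⟨⟨φ.toLinearMap.ker, φ.isClosed_ker, hfin⟩, ?_⟩
  have h1 : φ.toLinearMap.ker.liftQL φ le_rfl (φ.toLinearMap.ker.mkQL y) = φ y := rfl
  have h2 := ContinuousLinearMap.le_of_opNorm_le _ ((norm_lift_le φ.toLinearMap.ker φ le_rfl).trans hφ)
    (φ.toLinearMap.ker.mkQL y)
  rw [h1, hy, one_mul] at h2
  simpa using h2

/-- The preimage of a finite-codimensional closed subspace. -/
def CofinSubspace.comap {F F₀ : Type*} [NormedAddCommGroup F] [NormedSpace 𝕜 F]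
    [NormedAddCommGroup F₀] [NormedSpace 𝕜 F₀] (R : F →L[𝕜] F₀) (L : CofinSubspace 𝕜 F₀) :
    CofinSubspace 𝕜 F where
  space := L.space.comap R.toLinearMap
  closed := L.closed.preimage R.continuous
  finCodim := by
    have hk : L.space.comap R.toLinearMap = (L.space.mkQ.comp R.toLinearMap).ker := by
      rw [LinearMap.ker_comp, Submodule.ker_mkQ]
    rw [hk]
    exact (L.space.mkQ.comp R.toLinearMap).quotKerEquivRange.symm.finiteDimensional

theorem exists_cofin_factor {F F₀ : Type*} [NormedAddCommGroup F] [NormedSpace 𝕜 F]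
    [NormedAddCommGroup F₀] [NormedSpace 𝕜 F₀] (R : F →L[𝕜] F₀) (L : CofinSubspace 𝕜 F₀) :
    ∃ R' : (F ⧸ (L.comap R).space) →L[𝕜] (F₀ ⧸ L.space), ‖R'‖ₑ ≤ ‖R‖ₑ ∧
      ∀ y, L.space.mkQL (R y) = R' ((L.comap R).space.mkQL y) := by
  have hk : (L.comap R).space ≤ (L.space.mkQL ∘L R).ker := fun y hy =>
    (Submodule.Quotient.mk_eq_zero L.space).2 hy
  refine ⟨(L.comap R).space.liftQL (L.space.mkQL ∘L R) hk, ?_, fun y => rfl⟩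
  rw [← ofReal_norm, ← ofReal_norm]
  refine ENNReal.ofReal_le_ofReal ((norm_lift_le _ _ _).trans ?_)
  refine (ContinuousLinearMap.opNorm_comp_le _ _).trans ?_
  exact (mul_le_mul_of_nonneg_right (norm_mkQL_le L) (norm_nonneg _)).trans (one_mul _).le

end HullAux

namespace BanachLinIdeal

variable {𝕜 : Type} [RCLike 𝕜] (A : BanachLinIdeal.{u} 𝕜)

/-- The norm of the maximal hull:
`‖T‖ = sup {‖q_L ∘ T ∘ i_M‖_𝒜 | M ∈ FIN(E), L ∈ COFIN(F)}`, where `i_M : M → E` is the inclusion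
and `q_L : F → F ⧸ L` the quotient map. -/
def maxHullNrm {E F : Type u} [NormedAddCommGroup E] [NormedSpace 𝕜 E]
    [NormedAddCommGroup F] [NormedSpace 𝕜 F] [CompleteSpace F] (T : E →L[𝕜] F) : ℝ≥0∞ :=
  ⨆ p : FinDimSubspace 𝕜 E × CofinSubspace 𝕜 F,
    A.nrm (p.2.space.mkQL ∘L T ∘L p.1.space.subtypeL)

theorem enorm_le_maxHullNrm {E F : Type u} [NormedAddCommGroup E] [NormedSpace 𝕜 E]
    [NormedAddCommGroup F] [NormedSpace 𝕜 F] [CompleteSpace F] (T : E →L[𝕜] F) :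
    ‖T‖ₑ ≤ A.maxHullNrm T := by
  refine ContinuousLinearMap.opENorm_le_bound _ fun x => ?_
  obtain ⟨L, hL⟩ := exists_cofin_norm (𝕜 := 𝕜) (T x)
  let M : FinDimSubspace 𝕜 E := ⟨Submodule.span 𝕜 {x}, inferInstance⟩
  have hx : x ∈ M.space := Submodule.mem_span_singleton_self x
  have h1 : ‖T x‖ₑ ≤ ‖(L.space.mkQL ∘L T ∘L M.space.subtypeL) ⟨x, hx⟩‖ₑ := by
    rw [← ofReal_norm, ← ofReal_norm]
    exact ENNReal.ofReal_le_ofReal hL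
  refine h1.trans ((ContinuousLinearMap.le_opENorm _ _).trans ?_)
  refine mul_le_mul' ((A.enorm_le _).trans ?_) le_rfl
  exact le_iSup (fun p : FinDimSubspace 𝕜 E × CofinSubspace 𝕜 F =>
    A.nrm (p.2.space.mkQL ∘L T ∘L p.1.space.subtypeL)) (M, L)

/-- The maximal hull `𝒜^max` of `𝒜`. -/
def maxHull : BanachLinIdeal.{u} 𝕜 where
  nrm T := A.maxHullNrm T
  banach E F _ _ _ _ _ _ :=
    IsBanachENorm.iSup (V := E →L[𝕜] F) (ι := FinDimSubspace 𝕜 E × CofinSubspace 𝕜 F)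
      (W := fun p => p.1.space →L[𝕜] (F ⧸ p.2.space))
      (fun p =>
        { toFun := fun T => p.2.space.mkQL ∘L T ∘L p.1.space.subtypeL
          map_add' := fun S T => by ext; simp
          map_smul' := fun c T => by ext; simp })
      (fun p T => by
        refine (ContinuousLinearMap.opNorm_comp_le _ _).trans ?_
        refine (mul_le_mul (norm_mkQL_le p.2) (ContinuousLinearMap.opNorm_comp_le _ _)
          (norm_nonneg _) zero_le_one).trans ?_
        rw [one_mul]
        exact mul_le_of_le_one_right (norm_nonneg _) p.1.space.norm_subtypeL_le)
      (fun p T => A.nrm T) (fun p => A.banach _ _) (fun p T => A.enorm_le T)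
      (fun T => A.enorm_le_maxHullNrm T)
  enorm_le T := A.enorm_le_maxHullNrm T
  nrm_id := by
    apply le_antisymm
    · refine iSup_le fun p => (A.nrm_comp_le _ _ _).trans ?_
      rw [A.nrm_id, mul_one]
      exact (mul_le_mul' (enorm_mkQL_le p.2) (enorm_subtypeL_le p.1)).trans (one_mul _).le
    · refine le_trans ?_ (A.enorm_le_maxHullNrm _)
      have h := (ContinuousLinearMap.id 𝕜 (ULift.{u} 𝕜)).le_opENorm (ULift.up 1)
      have h4 : ‖ULift.up.{u} (1 : 𝕜)‖ₑ = 1 := by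
        rw [← ofReal_norm, ULift.norm_up, norm_one, ENNReal.ofReal_one]
      rwa [ContinuousLinearMap.id_apply, h4, mul_one] at h
  nrm_comp_le {E₀ E F F₀} _ _ _ _ _ _ _ _ _ _ _ _ R T S := by
    refine iSup_le fun p => ?_
    obtain ⟨M, L⟩ := p
    obtain ⟨R', hR', hfac⟩ := exists_cofin_factor R L
    let M' : FinDimSubspace 𝕜 E := ⟨M.space.map S.toLinearMap, inferInstance⟩
    let S' : M.space →L[𝕜] M'.space :=
      (S ∘L M.space.subtypeL).codRestrict M'.space fun x => ⟨x, x.2, rfl⟩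
    have hS' : ‖S'‖ₑ ≤ ‖S‖ₑ := by
      rw [← ofReal_norm, ← ofReal_norm]
      refine ENNReal.ofReal_le_ofReal ?_
      exact ContinuousLinearMap.opNorm_le_bound _ (norm_nonneg _) fun x => S.le_opNorm x
    have e : L.space.mkQL ∘L (R ∘L T ∘L S) ∘L M.space.subtypeL =
        R' ∘L ((L.comap R).space.mkQL ∘L T ∘L M'.space.subtypeL) ∘L S' := by
      ext x
      exact hfac (T (S x))
    change A.nrm (L.space.mkQL ∘L (R ∘L T ∘L S) ∘L M.space.subtypeL) ≤ _
    rw [e]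
    refine (A.nrm_comp_le _ _ _).trans (mul_le_mul' (mul_le_mul' hR' ?_) hS')
    exact le_iSup (fun p : FinDimSubspace 𝕜 E × CofinSubspace 𝕜 F =>
      A.nrm (p.2.space.mkQL ∘L T ∘L p.1.space.subtypeL)) (M', L.comap R)

end BanachLinIdeal

namespace BanachLipIdeal

variable {𝕜 : Type} [RCLike 𝕜] (I : BanachLipIdeal.{u} 𝕜)

/-- The norm of the maximal hull:
`‖f‖ = sup {‖q_L ∘ f ∘ i_{X₀}‖_ℐ | X₀ ∈ MFIN(X), L ∈ COFIN(E)}`, where `i_{X₀} : X₀ → X` is the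
inclusion and `q_L : E → E ⧸ L` the quotient map. -/
def maxHullNrm {X E : Type u} [MetricSpace X] [Zero X] [NormedAddCommGroup E] [NormedSpace 𝕜 E]
    [CompleteSpace E] (f : Lip0 X E) : ℝ≥0∞ :=
  ⨆ p : FinPointedSubset X × CofinSubspace 𝕜 E,
    I.nrm ((Lip0.ofLinear p.2.space.mkQL).comp (f.comp p.1.incl))

theorem enorm_le_maxHullNrm {X E : Type u} [MetricSpace X] [Zero X] [NormedAddCommGroup E]
    [NormedSpace 𝕜 E] [CompleteSpace E] (f : Lip0 X E) : ‖f‖ₑ ≤ I.maxHullNrm f := by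
  rcases eq_or_ne (I.maxHullNrm f) ∞ with h | h
  · rw [h]; exact le_top
  rw [← lip_eq_enorm, ← ENNReal.coe_toNNReal h, ENNReal.coe_le_coe]
  refine Lip0.lip_le fun x y => ?_
  rw [ENNReal.coe_toNNReal h, edist_eq_enorm_sub]
  obtain ⟨L, hL⟩ := exists_cofin_norm (𝕜 := 𝕜) (f x - f y)
  obtain ⟨X₀, hX₀⟩ : ∃ X₀ : FinPointedSubset X, X₀.carrier = {0, x, y} :=
    ⟨⟨{0, x, y}, by simp, by simp⟩, rfl⟩
  let x' : X₀.carrier := ⟨x, by simp [hX₀]⟩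
  let y' : X₀.carrier := ⟨y, by simp [hX₀]⟩
  let g : Lip0 X₀.carrier (E ⧸ L.space) := (Lip0.ofLinear L.space.mkQL).comp (f.comp X₀.incl)
  have h1 : ‖f x - f y‖ₑ ≤ edist (g x') (g y') := by
    rw [edist_eq_enorm_sub, ← ofReal_norm, ← ofReal_norm]
    exact ENNReal.ofReal_le_ofReal hL
  refine h1.trans ((g.lipschitzWith x' y').trans ?_)
  refine mul_le_mul' ((I.lip_le g).trans ?_) le_rfl
  exact le_iSup (fun p : FinPointedSubset X × CofinSubspace 𝕜 E =>
    I.nrm ((Lip0.ofLinear p.2.space.mkQL).comp (f.comp p.1.incl))) (X₀, L)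

/-- The maximal hull `ℐ^max` of `ℐ`. -/
def maxHull : BanachLipIdeal.{u} 𝕜 where
  nrm f := I.maxHullNrm f
  banach X E _ _ _ _ _ :=
    letI := Lip0.completeSpace 𝕜 X E
    IsBanachENorm.iSup (V := Lip0 X E) (ι := FinPointedSubset X × CofinSubspace 𝕜 E)
      (W := fun p => Lip0 p.1.carrier (E ⧸ p.2.space))
      (fun p =>
        { toFun := fun f => (Lip0.ofLinear p.2.space.mkQL).comp (f.comp p.1.incl)
          map_add' := fun f g => by ext; simp
          map_smul' := fun c f => by ext; simp })
      (fun p f => by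
        refine (Lip0.norm_ofLinear_comp_le _ _).trans ?_
        refine (mul_le_mul_of_nonneg_right (norm_mkQL_le p.2) (norm_nonneg _)).trans ?_
        rw [one_mul]
        exact Lip0.norm_le_of (norm_nonneg _) fun x y => f.norm_sub_le_dist x y)
      (fun p f => I.nrm f) (fun p => I.banach _ _) (fun p f => I.lip_le f)
      (fun f => I.enorm_le_maxHullNrm f)
  lip_le f := I.enorm_le_maxHullNrm f
  nrm_id := by
    apply le_antisymm
    · refine iSup_le fun p => (I.nrm_comp_le _ _ _).trans ?_
      rw [I.nrm_id, mul_one]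
      have h : p.1.incl.lip ≤ 1 := Lip0.lip_le (LipschitzWith.subtype_val _)
      exact (mul_le_mul' (by exact_mod_cast h) (enorm_mkQL_le p.2)).trans (one_mul _).le
    · refine le_trans ?_ (I.enorm_le_maxHullNrm _)
      rw [← lip_eq_enorm]
      have h3 := (Lip0.id (ULift.{u} 𝕜)).lipschitzWith.edist_le_mul (ULift.up 1) 0
      have h4 : edist (ULift.up (1 : 𝕜)) 0 = 1 := by
        rw [edist_zero_right, ← ofReal_norm, ULift.norm_up, norm_one, ENNReal.ofReal_one]
      rw [Lip0.id_apply, Lip0.id_apply, h4, mul_one] at h3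
      exact h3
  nrm_comp_le {Y X E F} _ _ _ _ _ _ _ _ _ _ S f g := by
    refine iSup_le fun p => ?_
    obtain ⟨Y₀, L⟩ := p
    obtain ⟨S', hS', hfac⟩ := exists_cofin_factor S L
    obtain ⟨X₀, hX₀⟩ : ∃ X₀ : FinPointedSubset X, ∀ y ∈ Y₀.carrier, g y ∈ X₀.carrier :=
      ⟨⟨g '' Y₀.carrier, Y₀.finite.image g, ⟨0, Y₀.zero_mem, g.map_zero⟩⟩,
        fun y hy => ⟨y, hy, rfl⟩⟩
    have hl : LipschitzWith g.lip
        (fun y : Y₀.carrier => (⟨g y, hX₀ y y.2⟩ : X₀.carrier)) :=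
      fun x y => g.lipschitzWith x y
    let g' : Lip0 Y₀.carrier X₀.carrier :=
      ⟨fun y => ⟨g y, hX₀ y y.2⟩, Subtype.ext g.map_zero, _, hl⟩
    have e : (Lip0.ofLinear L.space.mkQL).comp
          (((Lip0.ofLinear S).comp (f.comp g)).comp Y₀.incl) =
        (Lip0.ofLinear S').comp
          (((Lip0.ofLinear (L.comap S).space.mkQL).comp (f.comp X₀.incl)).comp g') := by
      ext y
      exact hfac (f (g y))
    change I.nrm ((Lip0.ofLinear L.space.mkQL).comp
          (((Lip0.ofLinear S).comp (f.comp g)).comp Y₀.incl)) ≤ _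
    rw [e]
    have hg : g'.lip ≤ g.lip := Lip0.lip_le hl
    refine (I.nrm_comp_le _ _ _).trans
      (mul_le_mul' (mul_le_mul' (by exact_mod_cast hg) ?_) hS')
    exact le_iSup (fun p : FinPointedSubset X × CofinSubspace 𝕜 E =>
      I.nrm ((Lip0.ofLinear p.2.space.mkQL).comp (f.comp p.1.incl))) (X₀, L.comap S)

end BanachLipIdeal

end LipIdeals

end

noncomputable section

namespace LipIdeals

variable {𝕜 : Type} [RCLike 𝕜]

/-! ### The maximal hull of a Banach linear operator ideal -/

namespace BanachLinIdeal

variable (A : BanachLinIdeal.{u} 𝕜)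
  {E F G : Type u} [NormedAddCommGroup E] [NormedSpace 𝕜 E] [CompleteSpace E]
  [NormedAddCommGroup F] [NormedSpace 𝕜 F] [CompleteSpace F]
  [NormedAddCommGroup G] [NormedSpace 𝕜 G] [CompleteSpace G]

/-! A hull norm is a supremum of ideal norms of compressions, between finite-dimensional spaces in
the linear case, and from finite pointed spaces to finite-dimensional spaces in the Lipschitz case.
The ideal property bounds each compression by the norm of the whole map, so any ideal that agrees
with the given one on such small spaces lies below the hull. On a small space the map is one of its
own compressions, up to contractions, so the hull itself agrees with the given ideal there. Each
hull is thus the greatest element of its class, and in particular its least upper bound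
(`isGreatest_maxHull`, for both kinds of ideals).

The commutation of hull and composition compares two suprema for the same operator `L_f : AE X → E`:
one over restrictions to finite-dimensional `M ⊆ AE X`, one over compositions with `AE X₀ → AE X`
for finite `X₀`. Since `AE X₀` is finite-dimensional and maps contractively onto a subspace of `AE
X`, the second supremum is at most the first (`compLip0_maxHull_nrm_le`).

The reverse inequality rests on `exists_lift_finPointedSubset`: up to `ε`, the inclusion of `M`
factors through some `AE X₀` by an operator of norm at most `1 + ε`. The error is small only in
operator norm, but its domain `M` is finite-dimensional, so `id_M` has finite ideal norm and the
error is small in the ideal norm too. Then `ε → 0`.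

The lift needs norms in `AE X₀` to be close to norms in `AE X`. For real scalars McShane extension
would make `AE X₀ → AE X` isometric, but complex-valued functions on `X₀` need not extend with the
same Lipschitz constant. What holds for both fields is that the norm of a fixed molecule over `X₀`
comes arbitrarily close to its norm over `X` as `X₀` grows (`exists_norm_moleculeOn_lt`).
Compactness of the unit ball of `M` makes this uniform. -/

theorem enorm_id_le (V : Type*) [NormedAddCommGroup V] [NormedSpace 𝕜 V] :
    ‖ContinuousLinearMap.id 𝕜 V‖ₑ ≤ 1 := by
  rw [← ofReal_norm]
  exact (ENNReal.ofReal_le_ofReal ContinuousLinearMap.norm_id_le).trans ENNReal.ofReal_one.le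

theorem nrm_comp_left_le (R : F →L[𝕜] G) (T : E →L[𝕜] F) :
    A.nrm (R ∘L T) ≤ ‖R‖ₑ * A.nrm T := by
  have h := A.nrm_comp_le R T (ContinuousLinearMap.id 𝕜 E)
  rw [ContinuousLinearMap.comp_id] at h
  exact h.trans ((mul_le_mul' le_rfl (enorm_id_le E)).trans (mul_one _).le)

theorem nrm_comp_right_le (T : F →L[𝕜] G) (S : E →L[𝕜] F) :
    A.nrm (T ∘L S) ≤ A.nrm T * ‖S‖ₑ := by
  have h := A.nrm_comp_le (ContinuousLinearMap.id 𝕜 G) T S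
  rw [ContinuousLinearMap.id_comp] at h
  exact h.trans (mul_le_mul' ((mul_le_mul' (enorm_id_le G) le_rfl).trans (one_mul _).le) le_rfl)

/-- A rank-one operator factors through the identity of the scalar field, whose ideal norm is one.
The `ULift` puts the scalars into the universe of the ideal. -/
theorem nrm_smulRight_lt_top (φ : StrongDual 𝕜 E) (y : F) : A.nrm (φ.smulRight y) < ∞ := by
  let e : ULift.{u} 𝕜 ≃L[𝕜] 𝕜 := ContinuousLinearEquiv.ulift
  have h : φ.smulRight y =
      (ContinuousLinearMap.toSpanSingleton 𝕜 y ∘L e.toContinuousLinearMap) ∘L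
        ContinuousLinearMap.id 𝕜 (ULift.{u} 𝕜) ∘L (e.symm.toContinuousLinearMap ∘L φ) := by
    ext x; simp
  rw [h]
  refine (A.nrm_comp_le _ _ _).trans_lt ?_
  rw [A.nrm_id]
  exact ENNReal.mul_lt_top (ENNReal.mul_lt_top enorm_lt_top ENNReal.one_lt_top) enorm_lt_top

theorem nrm_sum_lt_top {ι : Type*} (s : Finset ι) (T : ι → E →L[𝕜] F)
    (h : ∀ i ∈ s, A.nrm (T i) < ∞) : A.nrm (∑ i ∈ s, T i) < ∞ := by
  classical
  induction s using Finset.induction_on with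
  | empty =>
    have := (A.banach E F).smul 0 0
    simp only [zero_smul, enorm_zero, zero_mul] at this
    simp [this]
  | insert i s hi ih =>
    rw [Finset.sum_insert hi]
    exact ((A.banach E F).add_le _ _).trans_lt (ENNReal.add_lt_top.2
      ⟨h i (Finset.mem_insert_self i s), ih fun j hj => h j (Finset.mem_insert_of_mem hj)⟩)

/-- A basis writes the identity as a finite sum of rank-one operators. This finiteness later
converts a small operator norm on a finite-dimensional domain into a small ideal norm. -/
theorem nrm_id_lt_top [FiniteDimensional 𝕜 E] : A.nrm (ContinuousLinearMap.id 𝕜 E) < ∞ := by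
  let b := Module.finBasis 𝕜 E
  have h : ContinuousLinearMap.id 𝕜 E =
      ∑ i, (LinearMap.toContinuousLinearMap (b.coord i)).smulRight (b i) := by
    ext x
    simp [b.sum_repr]
  rw [h]
  exact A.nrm_sum_lt_top _ _ fun i _ => A.nrm_smulRight_lt_top _ _

theorem nrm_mkQL_comp_subtypeL_le (T : E →L[𝕜] F)
    (p : FinDimSubspace 𝕜 E × CofinSubspace 𝕜 F) :
    A.nrm (p.2.space.mkQL ∘L T ∘L p.1.space.subtypeL) ≤ A.nrm T := by
  refine (A.nrm_comp_le _ _ _).trans ?_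
  refine (mul_le_mul' (mul_le_mul' (enorm_mkQL_le p.2) le_rfl) (enorm_subtypeL_le p.1)).trans ?_
  rw [one_mul, mul_one]

theorem le_maxHullNrm (T : E →L[𝕜] F) (M : FinDimSubspace 𝕜 E) (L : CofinSubspace 𝕜 F) :
    A.nrm (L.space.mkQL ∘L T ∘L M.space.subtypeL) ≤ A.maxHull.nrm T :=
  le_iSup (fun p : FinDimSubspace 𝕜 E × CofinSubspace 𝕜 F =>
    A.nrm (p.2.space.mkQL ∘L T ∘L p.1.space.subtypeL)) (M, L)

end BanachLinIdeal

/-! ### Agreement with the ideal on finite-dimensional spaces, and maximality -/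

variable (𝕜) in
/-- The zero subspace of a finite-dimensional space, as a finite-codimensional subspace. -/
def CofinSubspace.bot (N : Type*) [NormedAddCommGroup N] [NormedSpace 𝕜 N]
    [FiniteDimensional 𝕜 N] : CofinSubspace 𝕜 N :=
  ⟨⊥, Submodule.closed_of_finiteDimensional _, inferInstance⟩

/-- The quotient by the zero subspace is a different type from `N`; lifting the identity of `N`
undoes the quotient map without increasing norms. -/
theorem CofinSubspace.exists_leftInverse_bot (N : Type*) [NormedAddCommGroup N] [NormedSpace 𝕜 N]
    [FiniteDimensional 𝕜 N] :
    ∃ R : (N ⧸ (CofinSubspace.bot 𝕜 N).space) →L[𝕜] N,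
      ‖R‖ₑ ≤ 1 ∧ ∀ y, R ((CofinSubspace.bot 𝕜 N).space.mkQL y) = y := by
  refine ⟨(CofinSubspace.bot 𝕜 N).space.liftQL (ContinuousLinearMap.id 𝕜 N) bot_le, ?_,
    fun _ => rfl⟩
  rw [← ofReal_norm]
  exact (ENNReal.ofReal_le_ofReal ((norm_lift_le _ _ _).trans
    ContinuousLinearMap.norm_id_le)).trans ENNReal.ofReal_one.le

theorem BanachLinIdeal.maxHull_mem_CLIN (A : BanachLinIdeal.{u} 𝕜) : A.maxHull ∈ CLIN A := by
  intro M N _ _ _ _ _ _ _ _ T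
  refine le_antisymm (iSup_le fun p => A.nrm_mkQL_comp_subtypeL_le T p) ?_
  obtain ⟨R, hR, hRq⟩ := CofinSubspace.exists_leftInverse_bot (𝕜 := 𝕜) N
  -- The whole domain and the zero subspace of the codomain form one index of the supremum; `J` and
  -- `R` are the contractions that recover `T` from this compression.
  let M' : FinDimSubspace 𝕜 M := ⟨⊤, inferInstance⟩
  let J : M →L[𝕜] M'.space :=
    (ContinuousLinearMap.id 𝕜 M).codRestrict M'.space fun _ => Submodule.mem_top
  have hJ : ‖J‖ₑ ≤ 1 := by
    rw [← ofReal_norm]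
    refine (ENNReal.ofReal_le_ofReal ?_).trans ENNReal.ofReal_one.le
    exact ContinuousLinearMap.opNorm_le_bound _ zero_le_one fun x => (one_mul ‖x‖).ge
  have e : T = R ∘L ((CofinSubspace.bot 𝕜 N).space.mkQL ∘L T ∘L M'.space.subtypeL) ∘L J := by
    ext x
    exact (hRq (T x)).symm
  calc A.nrm T
      = A.nrm (R ∘L ((CofinSubspace.bot 𝕜 N).space.mkQL ∘L T ∘L M'.space.subtypeL) ∘L J) :=
        congrArg A.nrm e
    _ ≤ 1 * A.maxHull.nrm T * 1 := (A.nrm_comp_le _ _ _).trans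
        (mul_le_mul' (mul_le_mul' hR (A.le_maxHullNrm T M' _)) hJ)
    _ = A.maxHull.nrm T := by rw [one_mul, mul_one]

/-- Each compression acts between finite-dimensional spaces, so its norm may be computed in any `B`
of the class, where the ideal property bounds it by `B.nrm T`. -/
theorem BanachLinIdeal.isGreatest_maxHull (A : BanachLinIdeal.{u} 𝕜) :
    IsGreatest (CLIN A) A.maxHull := by
  refine ⟨A.maxHull_mem_CLIN, fun B hB E F _ _ _ _ _ _ T hT => ?_⟩
  have h : A.maxHull.nrm T ≤ B.nrm T := iSup_le fun p => by
    rw [← hB]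
    exact B.nrm_mkQL_comp_subtypeL_le T p
  exact ⟨h.trans_lt hT, h⟩

/-! ### The maximal hull of a Banach Lipschitz operator ideal -/

namespace BanachLipIdeal

variable (I : BanachLipIdeal.{u} 𝕜)

theorem nrm_mkQL_comp_incl_le {X E : Type u} [MetricSpace X] [Zero X] [NormedAddCommGroup E]
    [NormedSpace 𝕜 E] [CompleteSpace E] (f : Lip0 X E)
    (p : FinPointedSubset X × CofinSubspace 𝕜 E) :
    I.nrm ((Lip0.ofLinear p.2.space.mkQL).comp (f.comp p.1.incl)) ≤ I.nrm f := by
  refine (I.nrm_comp_le _ _ _).trans ?_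
  have h : p.1.incl.lip ≤ 1 := Lip0.lip_le (LipschitzWith.subtype_val _)
  refine (mul_le_mul' (mul_le_mul' (ENNReal.coe_le_one_iff.2 h) le_rfl) (enorm_mkQL_le p.2)).trans ?_
  rw [one_mul, mul_one]

theorem le_maxHullNrm {X E : Type u} [MetricSpace X] [Zero X] [NormedAddCommGroup E]
    [NormedSpace 𝕜 E] [CompleteSpace E] (f : Lip0 X E) (X₀ : FinPointedSubset X)
    (L : CofinSubspace 𝕜 E) :
    I.nrm ((Lip0.ofLinear L.space.mkQL).comp (f.comp X₀.incl)) ≤ I.maxHull.nrm f :=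
  le_iSup (fun p : FinPointedSubset X × CofinSubspace 𝕜 E =>
    I.nrm ((Lip0.ofLinear p.2.space.mkQL).comp (f.comp p.1.incl))) (X₀, L)

theorem maxHull_mem_CLIP : I.maxHull ∈ CLIP I := by
  intro X N _ _ _ _ _ _ _ f
  refine le_antisymm (iSup_le fun p => I.nrm_mkQL_comp_incl_le f p) ?_
  obtain ⟨R, hR, hRq⟩ := CofinSubspace.exists_leftInverse_bot (𝕜 := 𝕜) N
  -- A finite `X` is one of its own finite pointed subsets.
  obtain ⟨X₀, hX₀⟩ : ∃ X₀ : FinPointedSubset X, ∀ x, x ∈ X₀.carrier :=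
    ⟨⟨Set.univ, Set.finite_univ, Set.mem_univ 0⟩, Set.mem_univ⟩
  have hl : LipschitzWith 1 (fun x : X => (⟨x, hX₀ x⟩ : X₀.carrier)) := fun x y => by
    simp [Subtype.edist_eq]
  let J : Lip0 X X₀.carrier := ⟨fun x => ⟨x, hX₀ x⟩, rfl, 1, hl⟩
  have hJ : J.lip ≤ 1 := Lip0.lip_le hl
  have e : f = (Lip0.ofLinear R).comp
      (((Lip0.ofLinear (CofinSubspace.bot 𝕜 N).space.mkQL).comp (f.comp X₀.incl)).comp J) := by
    ext x
    exact (hRq (f x)).symm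
  calc I.nrm f = I.nrm ((Lip0.ofLinear R).comp
      (((Lip0.ofLinear (CofinSubspace.bot 𝕜 N).space.mkQL).comp (f.comp X₀.incl)).comp J)) :=
        congrArg I.nrm e
    _ ≤ 1 * I.maxHull.nrm f * 1 := (I.nrm_comp_le _ _ _).trans
        (mul_le_mul' (mul_le_mul' (ENNReal.coe_le_one_iff.2 hJ) (I.le_maxHullNrm f X₀ _)) hR)
    _ = I.maxHull.nrm f := by rw [one_mul, mul_one]

/-- As in the linear case: compressions live where `J` and `I` agree, and the ideal property of `J`
bounds them. -/
theorem isGreatest_maxHull : IsGreatest (CLIP I) I.maxHull := by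
  refine ⟨I.maxHull_mem_CLIP, fun J hJ X E _ _ _ _ _ f hf => ?_⟩
  have h : I.maxHull.nrm f ≤ J.nrm f := iSup_le fun p => by
    have := p.1.finite.to_subtype
    rw [← hJ]
    exact J.nrm_mkQL_comp_incl_le f p
  exact ⟨h.trans_lt hf, h⟩

end BanachLipIdeal

/-! ### Local structure of the Arens–Eells space -/

section ArensEells

variable {𝕜 : Type} [RCLike 𝕜] {X : Type u} [MetricSpace X] [Zero X]

/-- The span of finitely many evaluations is finite-dimensional, hence already closed. -/
instance [Finite X] : FiniteDimensional 𝕜 (AE 𝕜 X) := by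
  have h : FiniteDimensional 𝕜 (Submodule.span 𝕜 (Set.range (dirac 𝕜 X))) :=
    FiniteDimensional.span_of_finite 𝕜 (Set.finite_range _)
  have e : arensEells 𝕜 X = Submodule.span 𝕜 (Set.range (dirac 𝕜 X)) :=
    (Submodule.closed_of_finiteDimensional _).submodule_topologicalClosure_eq
  have : FiniteDimensional 𝕜 (arensEells 𝕜 X) := e ▸ h
  exact this

variable (𝕜) in
/-- The operator `AE Y → AE X` induced by a Lipschitz map `Y → X`. -/
def AE.map {Y : Type*} [MetricSpace Y] [Zero Y] (g : Lip0 Y X) : AE 𝕜 Y →L[𝕜] AE 𝕜 X :=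
  linearization 𝕜 ((diracAE 𝕜 X).comp g)

@[simp] theorem AE.map_diracAE {Y : Type*} [MetricSpace Y] [Zero Y] (g : Lip0 Y X) (y : Y) :
    AE.map 𝕜 g (diracAE 𝕜 Y y) = diracAE 𝕜 X (g y) :=
  linearization_dirac _ y

theorem AE.norm_map_le_one {Y : Type*} [MetricSpace Y] [Zero Y] {g : Lip0 Y X}
    (hg : LipschitzWith 1 g) : ‖AE.map 𝕜 g‖ ≤ 1 := by
  rw [AE.map, norm_linearization]
  refine Lip0.norm_le_of zero_le_one fun x y => ?_
  refine ((diracAE 𝕜 X).norm_sub_le_dist _ _).trans ?_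
  exact mul_le_mul (norm_diracAE_le 𝕜) (by simpa using hg.dist_le_mul x y) dist_nonneg zero_le_one

/-! ### Molecules over finite pointed subsets -/

/-- A finite set, enlarged by the distinguished point. -/
def FinPointedSubset.ofFinset (s : Finset X) : FinPointedSubset X :=
  ⟨insert 0 (s : Set X), s.finite_toSet.insert 0, Set.mem_insert _ _⟩

omit [MetricSpace X] in
theorem FinPointedSubset.mem_ofFinset {s : Finset X} {x : X} (hx : x ∈ s) :
    x ∈ (ofFinset s).carrier :=
  Set.mem_insert_of_mem _ hx

open scoped Classical in
variable (𝕜) in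
/-- The evaluation at `x` in the Arens–Eells space of a finite pointed subset, zero if `x` is not
in this subset. -/
def diracOn (X₀ : FinPointedSubset X) (x : X) : AE 𝕜 X₀.carrier :=
  if h : x ∈ X₀.carrier then diracAE 𝕜 X₀.carrier ⟨x, h⟩ else 0

theorem diracOn_of_mem {X₀ : FinPointedSubset X} {x : X} (h : x ∈ X₀.carrier) :
    diracOn 𝕜 X₀ x = diracAE 𝕜 X₀.carrier ⟨x, h⟩ :=
  dif_pos h

theorem map_incl_diracOn {X₀ : FinPointedSubset X} {x : X} (h : x ∈ X₀.carrier) :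
    AE.map 𝕜 X₀.incl (diracOn 𝕜 X₀ x) = diracAE 𝕜 X x := by
  rw [diracOn_of_mem h, AE.map_diracAE]
  rfl

variable (𝕜) in
/-- The combination of evaluations on a finite pointed subset with given coefficients. -/
def moleculeOn (X₀ : FinPointedSubset X) : (X →₀ 𝕜) →ₗ[𝕜] AE 𝕜 X₀.carrier :=
  Finsupp.linearCombination 𝕜 (diracOn 𝕜 X₀)

variable (𝕜 X) in
/-- The combination of evaluations with given coefficients. -/
def molecule : (X →₀ 𝕜) →ₗ[𝕜] AE 𝕜 X :=
  Finsupp.linearCombination 𝕜 (diracAE 𝕜 X)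

theorem map_incl_moleculeOn {X₀ : FinPointedSubset X} {a : X →₀ 𝕜}
    (ha : ∀ x ∈ a.support, x ∈ X₀.carrier) :
    AE.map 𝕜 X₀.incl (moleculeOn 𝕜 X₀ a) = molecule 𝕜 X a := by
  simp only [moleculeOn, molecule, Finsupp.linearCombination_apply, Finsupp.sum, map_sum, map_smul]
  exact Finset.sum_congr rfl fun x hx => by rw [map_incl_diracOn (ha x hx)]

/-- The inclusion of the smaller subset induces a contraction of Arens–Eells spaces that carries one
molecule to the other, provided that no point of the support is cut off. This monotonicity supplies
the directedness in the compactness argument. -/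
theorem norm_moleculeOn_anti {X₀ X₁ : FinPointedSubset X} (h : X₀.carrier ⊆ X₁.carrier)
    {a : X →₀ 𝕜} (ha : ∀ x ∈ a.support, x ∈ X₀.carrier) :
    ‖moleculeOn 𝕜 X₁ a‖ ≤ ‖moleculeOn 𝕜 X₀ a‖ := by
  have hl : LipschitzWith 1 (Set.inclusion h) := fun x y => by simp [Subtype.edist_eq]
  let j : Lip0 X₀.carrier X₁.carrier := ⟨Set.inclusion h, rfl, 1, hl⟩
  have e : moleculeOn 𝕜 X₁ a = AE.map 𝕜 j (moleculeOn 𝕜 X₀ a) := by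
    simp only [moleculeOn, Finsupp.linearCombination_apply, Finsupp.sum, map_sum, map_smul]
    refine Finset.sum_congr rfl fun x hx => ?_
    rw [diracOn_of_mem (ha x hx), diracOn_of_mem (h (ha x hx)), AE.map_diracAE]
    rfl
  rw [e]
  exact ((AE.map 𝕜 j).le_of_opNorm_le (AE.norm_map_le_one hl) _).trans (one_mul _).le

theorem molecule_apply (a : X →₀ 𝕜) (f : Lip0 X 𝕜) :
    AE.incl 𝕜 X (molecule 𝕜 X a) f = ∑ x ∈ a.support, a x * f x := by
  simp [molecule, Finsupp.linearCombination_apply, Finsupp.sum]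

-- The zero extension of `f` here is the one whose pointwise limits are taken in the next lemma, so
-- the formula holds for every subset, whether or not it contains the support.
open scoped Classical in
theorem moleculeOn_apply (X₀ : FinPointedSubset X) (a : X →₀ 𝕜) (f : Lip0 X₀.carrier 𝕜) :
    AE.incl 𝕜 X₀.carrier (moleculeOn 𝕜 X₀ a) f =
      ∑ x ∈ a.support, a x * if h : x ∈ X₀.carrier then f ⟨x, h⟩ else 0 := by
  simp only [moleculeOn, Finsupp.linearCombination_apply, Finsupp.sum, map_sum, map_smul,
    sum_apply, smul_apply, smul_eq_mul]
  refine Finset.sum_congr rfl fun x _ => ?_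
  by_cases h : x ∈ X₀.carrier
  · rw [diracOn_of_mem h, dif_pos h]; rfl
  · rw [diracOn, dif_neg h, dif_neg h]; simp

open scoped Classical in
/-- The norm of a molecule in `AE X` is approached by its norms over the finite pointed subsets:
a cluster point of norming functions on these subsets is a norming function on `X`. -/
theorem exists_norm_moleculeOn_lt (s₁ : Finset X) (a : X →₀ 𝕜) {r : ℝ}
    (hr : ‖molecule 𝕜 X a‖ < r) :
    ∃ s : Finset X, ‖moleculeOn 𝕜 (FinPointedSubset.ofFinset (s ∪ s₁)) a‖ < r := by
  let P : Finset X → FinPointedSubset X := fun s => FinPointedSubset.ofFinset (s ∪ s₁)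
  by_contra! hcon
  -- Norms need not be attained by the functions chosen here; the slack between `r'` and `r`
  -- provides functions in the unit ball with value at least `r'`.
  obtain ⟨r', hr', hr'r⟩ := exists_between hr
  have hf : ∀ s : Finset X, ∃ f : Lip0 (P s).carrier 𝕜, ‖f‖ ≤ 1 ∧
      r' ≤ ‖AE.incl 𝕜 _ (moleculeOn 𝕜 (P s) a) f‖ := fun s => by
    have h : r' < ‖AE.incl 𝕜 _ (moleculeOn 𝕜 (P s) a)‖ := by
      rw [norm_incl]; exact hr'r.trans_le (hcon s)
    obtain ⟨f, hf1, hf2⟩ := ContinuousLinearMap.exists_lt_apply_of_lt_opNorm _ h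
    exact ⟨f, hf1.le, hf2.le⟩
  choose f hf1 hf2 using hf
  let F : X → Finset X → 𝕜 := fun x s =>
    if h : x ∈ (P s).carrier then f s ⟨x, h⟩ else 0
  have hF : ∀ x s, F x s ∈ Metric.closedBall (0 : 𝕜) (dist x 0) := fun x s => by
    rw [mem_closedBall_zero_iff]
    by_cases h : x ∈ (P s).carrier
    · simp only [F, dif_pos h]
      refine ((f s).norm_apply_le _).trans ?_
      exact (mul_le_mul_of_nonneg_right (hf1 s) dist_nonneg).trans (one_mul _).le
    · simp only [F, dif_neg h, norm_zero, dist_nonneg]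
  -- The zero extension is 1-Lipschitz only between points of `P s`, but any two given points belong
  -- to `P s` eventually.
  have hFsub : ∀ x y, ∀ᶠ s in atTop, ‖F x s - F y s‖ ≤ dist x y := fun x y => by
    refine eventually_atTop.2 ⟨{x, y}, fun s hs => ?_⟩
    have hx : x ∈ (P s).carrier :=
      FinPointedSubset.mem_ofFinset (Finset.mem_union_left _ (hs (by simp)))
    have hy : y ∈ (P s).carrier :=
      FinPointedSubset.mem_ofFinset (Finset.mem_union_left _ (hs (by simp)))
    simp only [F, dif_pos hx, dif_pos hy]
    refine ((f s).norm_sub_le_dist _ _).trans ?_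
    exact (mul_le_mul_of_nonneg_right (hf1 s) dist_nonneg).trans (one_mul _).le
  -- One ultrafilter finer than `atTop` yields limits at all points of `X` simultaneously, since the
  -- values at `x` stay in a compact ball, and it keeps every eventual inequality.
  let U : Ultrafilter (Finset X) := Ultrafilter.of atTop
  have hU : (U : Filter (Finset X)) ≤ atTop := Ultrafilter.of_le atTop
  have hlim : ∀ x, ∃ z, Tendsto (F x) U (𝓝 z) := fun x => by
    obtain ⟨z, -, hz⟩ := (isCompact_closedBall (0 : 𝕜) (dist x 0)).ultrafilter_le_nhds
      (U.map (F x)) (by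
        rw [le_principal_iff]
        exact Filter.mem_map.2 (Filter.univ_mem' (hF x)))
    exact ⟨z, hz⟩
  choose g hg using hlim
  have hg_sub : ∀ x y, ‖g x - g y‖ ≤ dist x y := fun x y =>
    le_of_tendsto ((hg x).sub (hg y)).norm (hU (hFsub x y))
  -- The ball that contains the values at `0` has radius `dist 0 0 = 0`.
  have hg0 : g 0 = 0 := by
    refine norm_le_zero_iff.1 (le_of_tendsto (hg 0).norm (Eventually.of_forall fun s => ?_))
    simpa using hF 0 s
  let G : Lip0 X 𝕜 := ⟨g, hg0, 1, LipschitzWith.of_dist_le_mul fun x y => by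
    rw [dist_eq_norm, NNReal.coe_one, one_mul]; exact hg_sub x y⟩
  have hG : ‖G‖ ≤ 1 := Lip0.norm_le_of zero_le_one fun x y => by
    rw [one_mul]; exact hg_sub x y
  have h1 : r' ≤ ‖AE.incl 𝕜 X (molecule 𝕜 X a) G‖ := by
    rw [molecule_apply]
    refine ge_of_tendsto (tendsto_finsetSum a.support fun x _ => (hg x).const_mul (a x)).norm
      (Eventually.of_forall fun s => ?_)
    have := hf2 s
    rwa [moleculeOn_apply] at this
  -- The limit function `G` lies in the unit ball, so `h1` forces `r' ≤ ‖molecule 𝕜 X a‖`, against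
  -- the choice of `r'`.
  have h2 := (AE.incl 𝕜 X (molecule 𝕜 X a)).le_opNorm G
  rw [norm_incl] at h2
  nlinarith [norm_nonneg (molecule 𝕜 X a)]

theorem exists_norm_molecule_sub_lt (φ : AE 𝕜 X) {ε : ℝ} (hε : 0 < ε) :
    ∃ a : X →₀ 𝕜, ‖molecule 𝕜 X a - φ‖ < ε := by
  have hφ : AE.incl 𝕜 X φ ∈
      closure (Submodule.span 𝕜 (Set.range (dirac 𝕜 X)) : Set (StrongDual 𝕜 (Lip0 X 𝕜))) := φ.2
  obtain ⟨u, hu, hd⟩ := Metric.mem_closure_iff.1 hφ ε hε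
  obtain ⟨a, rfl⟩ := (Finsupp.mem_span_range_iff_exists_finsupp).1 hu
  refine ⟨a, ?_⟩
  have e : AE.incl 𝕜 X (molecule 𝕜 X a) = a.sum fun x c => c • dirac 𝕜 X x := by
    simp [molecule, Finsupp.linearCombination_apply, Finsupp.sum]
  rwa [← norm_incl, map_sub, e, ← dist_eq_norm, dist_comm]

/-! ### Almost contractive lifts of finite-dimensional subspaces -/

/-- Finite-dimensional subspaces of `AE X` lift, up to `ε`, to the Arens–Eells space of a finite
pointed subset. -/
theorem exists_lift_finPointedSubset (M : FinDimSubspace 𝕜 (AE 𝕜 X)) {ε : ℝ} (hε : 0 < ε) :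
    ∃ (X₀ : FinPointedSubset X) (S : M.space →L[𝕜] AE 𝕜 X₀.carrier),
      ‖S‖ ≤ 1 + ε ∧ ‖M.space.subtypeL - AE.map 𝕜 X₀.incl ∘L S‖ ≤ ε := by
  classical
  let b := Module.finBasis 𝕜 M.space
  -- An operator on `M` that is at most `δ` on the basis has norm at most `C * δ`; so approximating
  -- the basis vectors within `ε / 2 / C` approximates the inclusion of `M` within `ε / 2`.
  obtain ⟨C, hC, hb⟩ := b.exists_opNorm_le (F := AE 𝕜 X)
  choose a ha using fun i => exists_norm_molecule_sub_lt (b i : AE 𝕜 X)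
    (show 0 < ε / 2 / C by positivity)
  let l : M.space →ₗ[𝕜] (X →₀ 𝕜) := b.constr 𝕜 a
  have hl : ∀ i, l (b i) = a i := fun i => b.constr_basis 𝕜 a i
  -- By linearity the supports of the approximating basis molecules contain those of all `l m`, so
  -- every `P s` carries all the molecules at once.
  let s₁ : Finset X := Finset.univ.biUnion fun i => (a i).support
  have hls : ∀ m, ∀ x ∈ (l m).support, x ∈ s₁ := fun m => by
    have h : l m ∈ Finsupp.supported 𝕜 𝕜 (s₁ : Set X) := by
      rw [← b.sum_repr m, map_sum]
      refine Submodule.sum_mem _ fun i _ => ?_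
      rw [map_smul, hl]
      refine Submodule.smul_mem _ _ ((Finsupp.mem_supported 𝕜 _).2 ?_)
      exact_mod_cast Finset.subset_biUnion_of_mem (fun i => (a i).support) (Finset.mem_univ i)
    exact fun x hx => (Finsupp.mem_supported 𝕜 _).1 h hx
  let P : Finset X → FinPointedSubset X := fun s => FinPointedSubset.ofFinset (s ∪ s₁)
  have hP : ∀ s m, ∀ x ∈ (l m).support, x ∈ (P s).carrier := fun s m x hx =>
    FinPointedSubset.mem_ofFinset (Finset.mem_union_right _ (hls m x hx))
  have hPmono : ∀ s t, s ⊆ t → (P s).carrier ⊆ (P t).carrier := fun s t hst =>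
    Set.insert_subset_insert (by exact_mod_cast Finset.union_subset_union_left hst)
  let S : ∀ s, M.space →L[𝕜] AE 𝕜 (P s).carrier := fun s =>
    LinearMap.toContinuousLinearMap (moleculeOn 𝕜 (P s) ∘ₗ l)
  have hS : ∀ s m, S s m = moleculeOn 𝕜 (P s) (l m) := fun _ _ => rfl
  have hmap : ∀ s m, AE.map 𝕜 (P s).incl (S s m) = molecule 𝕜 X (l m) := fun s m =>
    map_incl_moleculeOn (hP s m)
  -- Once pushed into `AE X` the molecules no longer depend on `s`, so the error bound holds for
  -- every `s`, which leaves `s` free to control the norm of the lift.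
  have hdiff : ∀ s, ‖M.space.subtypeL - AE.map 𝕜 (P s).incl ∘L S s‖ ≤ ε / 2 := fun s => by
    refine (hb (show 0 ≤ ε / 2 / C by positivity) fun i => ?_).trans
      (mul_div_cancel₀ _ hC.ne').le
    rw [_root_.sub_apply, ContinuousLinearMap.comp_apply, hmap, hl, norm_sub_rev]
    exact (ha i).le
  have hmol : ∀ m ∈ Metric.closedBall (0 : M.space) 1, ‖molecule 𝕜 X (l m)‖ < 1 + ε :=
      fun m hm => by
    rw [mem_closedBall_zero_iff] at hm
    -- Any `s` would do here; the norm on the ball is at most `1 + ε / 2`, and the remaining `ε / 2`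
    -- gives the strict inequality.
    have h1 := ContinuousLinearMap.le_of_opNorm_le _ (hdiff ∅) m
    rw [_root_.sub_apply, ContinuousLinearMap.comp_apply, hmap] at h1
    have h2 : ‖molecule 𝕜 X (l m)‖ ≤ ‖M.space.subtypeL m‖ +
        ‖M.space.subtypeL m - molecule 𝕜 X (l m)‖ := norm_le_insert _ _
    have h3 : ‖M.space.subtypeL m‖ = ‖m‖ := rfl
    rw [h3] at h2
    nlinarith
  have := FiniteDimensional.proper 𝕜 M.space
  -- A Dini argument: the open sets where the lift has norm below `1 + ε` cover the compact unit
  -- ball and increase with `s`, so a single one contains the ball.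
  obtain ⟨s, hs⟩ := (isCompact_closedBall (0 : M.space) 1).elim_directed_cover
    (fun s => {m | ‖S s m‖ < 1 + ε})
    (fun s => isOpen_lt (S s).continuous.norm continuous_const)
    (fun m hm => by
      exact Set.mem_iUnion.2 (exists_norm_moleculeOn_lt s₁ (l m) (hmol m hm)))
    (fun s t => ⟨s ∪ t,
      fun m hm => (norm_moleculeOn_anti (hPmono _ _ Finset.subset_union_left) (hP s m)).trans_lt hm,
      fun m hm => (norm_moleculeOn_anti (hPmono _ _ Finset.subset_union_right)
        (hP t m)).trans_lt hm⟩)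
  refine ⟨P s, S s, ?_, (hdiff s).trans (by linarith)⟩
  refine ContinuousLinearMap.opNorm_le_of_unit_norm (by positivity) fun m hm => ?_
  exact (hs (mem_closedBall_zero_iff.2 hm.le)).le

end ArensEells

/-! ### The maximal hull of `𝒜 ∘ Lip0` -/

namespace BanachLinIdeal

variable {𝕜 : Type} [RCLike 𝕜] (A : BanachLinIdeal.{u} 𝕜)
  {X E : Type u} [MetricSpace X] [Zero X] [NormedAddCommGroup E] [NormedSpace 𝕜 E]
  [CompleteSpace E]

/-- This puts both hull norms of `f` in terms of compressions of the one operator `L_f`, leaving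
only `AE X₀ → AE X` to be compared with the inclusions `M → AE X`. -/
theorem linearization_mkQL_comp_incl (f : Lip0 X E) (X₀ : FinPointedSubset X)
    (L : CofinSubspace 𝕜 E) :
    linearization 𝕜 ((Lip0.ofLinear L.space.mkQL).comp (f.comp X₀.incl)) =
      L.space.mkQL ∘L linearization 𝕜 f ∘L AE.map 𝕜 X₀.incl := by
  rw [linearization_ofLinear_comp, linearization_comp]
  rfl

/-- The image of `AE X₀` in `AE X` is an admissible `M`, and `AE X₀ → M` is a contraction, so each
Lipschitz compression is dominated by a linear one. -/
theorem compLip0_maxHull_nrm_le (f : Lip0 X E) :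
    A.compLip0.maxHull.nrm f ≤ A.maxHull.compLip0.nrm f := by
  refine iSup_le fun p => ?_
  obtain ⟨X₀, L⟩ := p
  have := X₀.finite.to_subtype
  let j := AE.map 𝕜 X₀.incl
  let M : FinDimSubspace 𝕜 (AE 𝕜 X) := ⟨j.toLinearMap.range, inferInstance⟩
  let J : AE 𝕜 X₀.carrier →L[𝕜] M.space := j.codRestrict M.space fun φ => ⟨φ, rfl⟩
  have hJ : ‖J‖ₑ ≤ 1 := by
    rw [← ofReal_norm]
    refine (ENNReal.ofReal_le_ofReal ?_).trans ENNReal.ofReal_one.le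
    exact ContinuousLinearMap.opNorm_le_bound _ zero_le_one fun φ =>
      j.le_of_opNorm_le (AE.norm_map_le_one (LipschitzWith.subtype_val _)) φ
  have e : linearization 𝕜 ((Lip0.ofLinear L.space.mkQL).comp (f.comp X₀.incl)) =
      (L.space.mkQL ∘L linearization 𝕜 f ∘L M.space.subtypeL) ∘L J := by
    rw [linearization_mkQL_comp_incl]
    rfl
  calc A.nrm (linearization 𝕜 ((Lip0.ofLinear L.space.mkQL).comp (f.comp X₀.incl)))
      ≤ A.nrm (L.space.mkQL ∘L linearization 𝕜 f ∘L M.space.subtypeL) * ‖J‖ₑ := by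
        rw [e]; exact A.nrm_comp_right_le _ _
    _ ≤ A.maxHull.nrm (linearization 𝕜 f) * 1 :=
        mul_le_mul' (A.le_maxHullNrm _ M L) hJ
    _ = A.maxHull.compLip0.nrm f := mul_one _

/-- Up to `ε`, the inclusion of `M` passes through some `AE X₀`; the main term is then bounded by a
Lipschitz compression and the error by `ε * K`. -/
theorem maxHull_compLip0_nrm_le (f : Lip0 X E) :
    A.maxHull.compLip0.nrm f ≤ A.compLip0.maxHull.nrm f := by
  refine iSup_le fun p => ?_
  obtain ⟨M, L⟩ := p
  let H := A.compLip0.maxHull.nrm f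
  let T : AE 𝕜 X →L[𝕜] (E ⧸ L.space) := L.space.mkQL ∘L linearization 𝕜 f
  let K : ℝ≥0∞ := ‖T‖ₑ * A.nrm (ContinuousLinearMap.id 𝕜 M.space)
  change A.nrm (T ∘L M.space.subtypeL) ≤ H
  rcases eq_or_ne H ∞ with hH | hH
  -- For infinite `H` the bound is trivial; finiteness of `H` and `K` is what makes `ε * (H + K)`
  -- vanish in the limit.
  · rw [hH]; exact le_top
  have hK : K ≠ ∞ := ENNReal.mul_ne_top enorm_ne_top A.nrm_id_lt_top.ne
  have key : ∀ ε : ℝ≥0, 0 < ε → A.nrm (T ∘L M.space.subtypeL) ≤ H + ε * (H + K) := by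
    intro ε hε
    obtain ⟨X₀, S, hS, hD⟩ := exists_lift_finPointedSubset M (NNReal.coe_pos.2 hε)
    let j := AE.map 𝕜 X₀.incl
    -- The redundant identity of `M` lets the error be measured as an operator norm times the ideal
    -- norm of the identity.
    have e : T ∘L M.space.subtypeL = (T ∘L j) ∘L S +
        (T ∘L (M.space.subtypeL - j ∘L S)) ∘L ContinuousLinearMap.id 𝕜 M.space := by
      ext m; simp [j]
    have hS' : ‖S‖ₑ ≤ 1 + ε := by
      have : ‖S‖₊ ≤ 1 + ε := by exact_mod_cast hS
      exact_mod_cast this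
    have hD' : ‖T ∘L (M.space.subtypeL - j ∘L S)‖ₑ ≤ ‖T‖ₑ * ε := by
      have h1 : ‖T ∘L (M.space.subtypeL - j ∘L S)‖₊ ≤ ‖T‖₊ * ε := by
        have := (ContinuousLinearMap.opNorm_comp_le T (M.space.subtypeL - j ∘L S)).trans
          (mul_le_mul_of_nonneg_left hD (norm_nonneg T))
        exact_mod_cast this
      have h2 : (‖T ∘L (M.space.subtypeL - j ∘L S)‖₊ : ℝ≥0∞) ≤ ‖T‖₊ * ε := by exact_mod_cast h1
      exact h2
    have hT : A.nrm (T ∘L j) ≤ H := by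
      have := A.compLip0.le_maxHullNrm f X₀ L
      rwa [show A.compLip0.nrm ((Lip0.ofLinear L.space.mkQL).comp (f.comp X₀.incl)) =
        A.nrm (T ∘L j) from congrArg A.nrm (linearization_mkQL_comp_incl f X₀ L)] at this
    calc A.nrm (T ∘L M.space.subtypeL)
        ≤ A.nrm ((T ∘L j) ∘L S) + A.nrm ((T ∘L (M.space.subtypeL - j ∘L S)) ∘L
            ContinuousLinearMap.id 𝕜 M.space) := by
          rw [e]; exact (A.banach _ _).add_le _ _
      _ ≤ H * (1 + ε) + ‖T‖ₑ * ε * A.nrm (ContinuousLinearMap.id 𝕜 M.space) :=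
          add_le_add ((A.nrm_comp_right_le _ _).trans (mul_le_mul' hT hS'))
            ((A.nrm_comp_left_le _ _).trans (mul_le_mul' hD' le_rfl))
      _ = H + ε * (H + K) := by ring
  have hlim : Tendsto (fun ε : ℝ≥0 => H + ε * (H + K)) (𝓝[>] 0) (𝓝 (H + (0 : ℝ≥0) * (H + K))) :=
    tendsto_nhdsWithin_of_tendsto_nhds (tendsto_const_nhds.add
      (ENNReal.Tendsto.mul_const (ENNReal.tendsto_coe.2 tendsto_id)
        (Or.inr (ENNReal.add_ne_top.2 ⟨hH, hK⟩))))
  rw [ENNReal.coe_zero, zero_mul, add_zero] at hlim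
  exact ge_of_tendsto hlim (eventually_nhdsWithin_of_forall fun ε hε => key ε hε)

/-- `(𝒜 ∘ Lip0)^max = 𝒜^max ∘ Lip0`. -/
theorem compLip0_maxHull : A.compLip0.maxHull = A.maxHull.compLip0 :=
  BanachLipIdeal.nrm_injective fun _ _ _ _ _ _ _ f =>
    le_antisymm (A.compLip0_maxHull_nrm_le f) (A.maxHull_compLip0_nrm_le f)

end BanachLinIdeal

end LipIdeals

end

theorem mainTheorem5 (𝕜 : Type) [RCLike 𝕜] (A : LipIdeals.BanachLinIdeal.{u} 𝕜) :
    -- `(𝒜 ∘ Lip0)^max = 𝒜^max ∘ Lip0` isometrically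
    A.compLip0.maxHull = A.maxHull.compLip0 ∧
    -- `𝒜^max = ⋁ CLIN_𝒜`, and it belongs to `CLIN_𝒜`
    (IsLUB (LipIdeals.CLIN A) A.maxHull ∧ A.maxHull ∈ LipIdeals.CLIN A) ∧
    -- `(𝒜 ∘ Lip0)^max = ⋁ CLIP_{𝒜 ∘ Lip0}`, and it belongs to `CLIP_{𝒜 ∘ Lip0}`
    (IsLUB (LipIdeals.CLIP A.compLip0) A.compLip0.maxHull ∧
      A.compLip0.maxHull ∈ LipIdeals.CLIP A.compLip0) ∧
    -- `(𝒜 ∘ Lip0)^max = ψ(⋁ CLIN_𝒜)` with `ψ(ℬ) = ℬ ∘ Lip0`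
    (∀ S : LipIdeals.BanachLinIdeal.{u} 𝕜, IsLUB (LipIdeals.CLIN A) S →
      A.compLip0.maxHull = S.compLip0) := by
  exact ⟨A.compLip0_maxHull, ⟨A.isGreatest_maxHull.isLUB, A.maxHull_mem_CLIN⟩,
    ⟨A.compLip0.isGreatest_maxHull.isLUB, A.compLip0.maxHull_mem_CLIP⟩, fun S hS => by
      rw [hS.unique A.isGreatest_maxHull.isLUB, A.compLip0_maxHull]⟩
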